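/- Let $d,\gamma\ge 1$ be integers, $\mathbb T=\mathbb R/2\pi\mathbb Z$, and let $\Delta_\gamma=\Delta_x+|x|^{2\gamma}\Delta_y$, $(x,y)\in\mathbb R^d\times\mathbb T^d$, be the Baouendi–Grushin operator on $L^2(\mathbb R^d\times\mathbb T^d)$, with maximal domain $\{u\in L^2:\Delta_\gamma u\in L^2\}$, where $\Delta_\gamma u$ is taken in the sense of distributions. An eigenpair of $-\Delta_\gamma$ is a pair $(\lambda,\psi)$ with $\lambda\in\mathbb R$, $0\ne\psi\in L^2(\mathbb R^d\times\mathbb T^d)$ and $-\Delta_\gamma\psi=\lambda\psi$. Let $\omega\subset\mathbb R^d\times\mathbb T^d$ be a measurable set with $\overline\omega\cap\{x=0\}=\emptyset$. Then there exist constants $c_0,c_1>0$ and a sequence $((\lambda_n,\psi_n))_n$ of eigenpairs of $-\Delta_\gamma$ with $\lambda_n\to+\infty$ such that for every $n$ $$\|\psi_n\|_{L^2(\mathbb R^d\times\mathbb T^d)}\ \ge\ c_0\,e^{c_1\lambda_n^{(1+\gamma)/2}}\,\|\psi_n\|_{L^2(\omega)}.$$ Hence the power $(1+\gamma)/2$ of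 $\lambda$ in spectral inequalities for $-\Delta_\gamma$ cannot be lowered for such $\omega$, not even for single eigenfunctions: if $\eta,C,K\in\mathbb R$ are such that $$\|\psi\|_{L^2(\mathbb R^d\times\mathbb T^d)}\le C\,e^{K(1+\lambda)^{\eta}}\,\|\psi\|_{L^2(\omega)}\quad\text{for all eigenpairs }(\lambda,\psi)\text{ of }-\Delta_\gamma,$$ then $\eta\ge(1+\gamma)/2$. -/

import Mathlib

open MeasureTheory Filter Topology

noncomputable section

namespace Grushin

instance fact_two_pi_pos : Fact (0 < 2 * Real.pi) := ⟨Real.two_pi_pos⟩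

/-- The Euclidean space `ℝ^d`. -/
abbrev Space (d : ℕ) : Type := EuclideanSpace ℝ (Fin d)

/-- The torus `𝕋^d = (ℝ / 2πℤ)^d`, with its product topology and product Lebesgue measure. -/
abbrev Torus (d : ℕ) : Type := Fin d → AddCircle (2 * Real.pi)

/-- The cylinder `ℝ^d × 𝕋^d`; its `volume` is the product measure. -/
abbrev Cylinder (d : ℕ) : Type := Space d × Torus d

/-- The canonical projection `ℝ^d → 𝕋^d`. -/
def toTorus {d : ℕ} (v : Space d) : Torus d := fun i => ((v i : ℝ) : AddCircle (2 * Real.pi))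

/-- The complex Hilbert space `L²(ℝ^d × 𝕋^d)`. -/
abbrev L2 (d : ℕ) : Type := Lp ℂ 2 (volume : Measure (Cylinder d))

/-- The norm of (the restriction of) `ψ` in `L²(ω)`. -/
def normOn {d : ℕ} (ω : Set (Cylinder d)) (ψ : L2 d) : ℝ :=
  (eLpNorm ψ 2 ((volume : Measure (Cylinder d)).restrict ω)).toReal

/-- Test functions on the cylinder, i.e. elements of `C_c^∞(ℝ^d × 𝕋^d)`: compactly supported
functions whose lift to `ℝ^d × ℝ^d` is smooth. -/
structure IsTestFunction {d : ℕ} (φ : Cylinder d → ℂ) : Prop where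
  smooth : ContDiff ℝ ((⊤ : ℕ∞) : WithTop ℕ∞)
    (fun p : Space d × Space d => φ (p.1, toTorus p.2))
  compactSupport : HasCompactSupport φ

/-- The Laplacian in the variable `x ∈ ℝ^d`. -/
def laplacianX {d : ℕ} (φ : Cylinder d → ℂ) (z : Cylinder d) : ℂ :=
  Laplacian.laplacian (fun x : Space d => φ (x, z.2)) z.1

/-- The Laplacian in the variable `y ∈ 𝕋^d`, computed in the chart `v ↦ y + v` (mod `2π`)
centred at the given point `y`. -/
def laplacianY {d : ℕ} (φ : Cylinder d → ℂ) (z : Cylinder d) : ℂ :=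
  Laplacian.laplacian (fun v : Space d => φ (z.1, z.2 + toTorus v)) 0

/-- The Baouendi–Grushin differential expression `Δ_γ φ = Δ_x φ + |x|^{2γ} Δ_y φ` on smooth
functions. -/
def grushin {d : ℕ} (γ : ℕ) (φ : Cylinder d → ℂ) (z : Cylinder d) : ℂ :=
  laplacianX φ z + ((‖z.1‖ ^ (2 * γ) : ℝ) : ℂ) * laplacianY φ z

/-- The graph of the operator `-Δ_γ` on `L²(ℝ^d × 𝕋^d)` with its maximal domain
`{u ∈ L² : Δ_γ u ∈ L²}`: the pairs `u, f ∈ L²` with `-Δ_γ u = f` in the sense of distributions. -/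
def NegGrushinEq {d : ℕ} (γ : ℕ) (u f : L2 d) : Prop :=
  ∀ φ : Cylinder d → ℂ, IsTestFunction φ →
    ∫ z, u z * -(grushin γ φ z) = ∫ z, f z * φ z

/-- `(lam, ψ)` is an eigenpair of `-Δ_γ`. -/
def IsEigenpair {d : ℕ} (γ : ℕ) (lam : ℝ) (ψ : L2 d) : Prop :=
  ψ ≠ 0 ∧ NegGrushinEq γ ψ ((lam : ℂ) • ψ)

end Grushin

end

/-!
Separating variables, `ψ(x, y) = e^{i n y₀} g(a |x|)` with `a^{γ+1} = n` satisfies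
`-Δ_γ ψ = λ a² ψ` as soon as `g(|x|)` is an eigenfunction of `-Δ + |x|^{2γ}` on `ℝ^d` with
eigenvalue `λ`. If `g` decays like `e^{-κ r^{γ+1}}`, then at distance at least `δ` from `{x = 0}`
the function `ψ` is smaller than its total mass by a factor `e^{-c n}`, and
`(λ a²)^{(1+γ)/2} = λ^{(1+γ)/2} n` is proportional to `n`. Since the torus is compact, a set whose
closure misses `{x = 0}` stays at such a positive distance. Letting `n → ∞` gives the sequence of
eigenpairs, and comparing `λ^{(1+γ)/2}` with `(1+λ)^η` gives the optimality of the exponent.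

The radial ground state `g` is obtained by a shooting argument. For each `λ` there is a unique
radial solution with `g(0) = 1`, namely `g(r) = f(r²)` with `f` an entire power series
(`radialSol`, `radialSol_ode`). If `λ` is too small, `g` stays positive but starts to grow beyond
the turning point `r^{2γ} = λ`; if `λ` is too large, `g` becomes negative. Both conditions are open,
exclude each other, and occur, so by connectedness of `ℝ` some `λ > 0` satisfies neither
(`exists_critical`). For this `λ` the solution is positive and decreasing beyond the turning point.
With the flux `p = r^{d-1} g'`, the quantity `p² - r^{2(d-1)} (r^{2γ} - λ) g²` is decreasing there,
and it cannot become negative without forcing `p` to become positive (`flux_sq_ge`); hence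
`g' ≤ -√(r^{2γ} - λ) g`, which integrates to the decay (`exists_ground_state`).

The modes are smooth, so the distributional eigenvalue equation follows from the pointwise one by
Green's formula, which holds because the integral of a directional derivative of a compactly
supported function vanishes, the measure being translation invariant
(`integral_dirDeriv_eq_zero`, `integral_mul_neg_grushin`).
-/

noncomputable section

namespace Grushin

/-! ### Entire power series and the radial equation -/

/-- The real power series with coefficients `a` converges on the whole line. -/
def IsEntire (a : ℕ → ℝ) : Prop := ∀ ρ : ℝ, Summable fun k => a k * ρ ^ k

/-- The sum of the power series with coefficients `a` at the point `t`. -/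
def seriesSum (a : ℕ → ℝ) (t : ℝ) : ℝ := ∑' k, a k * t ^ k

/-- The coefficients of the formal derivative of the power series with coefficients `a`. -/
def derivCoeff (a : ℕ → ℝ) (k : ℕ) : ℝ := (k + 1) * a (k + 1)

theorem IsEntire.of_bounded {a : ℕ → ℝ}
    (h : ∀ ρ : ℝ, 0 < ρ → ∃ B : ℝ, ∀ k, |a k| * ρ ^ k ≤ B) : IsEntire a := by
  intro ρ
  obtain ⟨B, hB⟩ := h (2 * (|ρ| + 1)) (by positivity)
  have hs : Summable fun k : ℕ => B * (1 / 2 : ℝ) ^ k :=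
    (summable_geometric_of_lt_one (by norm_num) (by norm_num)).mul_left B
  refine Summable.of_norm_bounded hs fun k => ?_
  rw [norm_mul, norm_pow, Real.norm_eq_abs, Real.norm_eq_abs]
  have h1 : |ρ| ^ k ≤ (|ρ| + 1) ^ k := by gcongr; linarith
  have h2 := hB k
  rw [mul_pow] at h2
  have h3 : |a k| * (|ρ| + 1) ^ k = |a k| * (2 ^ k * (|ρ| + 1) ^ k) * (1 / 2 : ℝ) ^ k := by
    rw [one_div, inv_pow]; field_simp
  calc |a k| * |ρ| ^ k ≤ |a k| * (|ρ| + 1) ^ k := by gcongr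
    _ ≤ B * (1 / 2 : ℝ) ^ k := by rw [h3]; gcongr

theorem IsEntire.abs_summable {a : ℕ → ℝ} (h : IsEntire a) {ρ : ℝ} (hρ : 0 ≤ ρ) :
    Summable fun k => |a k| * ρ ^ k := by
  have := (h ρ).abs
  simpa [abs_mul, abs_pow, abs_of_nonneg hρ] using this

theorem IsEntire.derivCoeff {a : ℕ → ℝ} (h : IsEntire a) : IsEntire (derivCoeff a) := by
  refine IsEntire.of_bounded fun ρ hρ => ?_
  have hs := h.abs_summable (ρ := 2 * (ρ + 1)) (by positivity)
  refine ⟨∑' k, |a k| * (2 * (ρ + 1)) ^ k, fun k => ?_⟩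
  refine le_trans ?_ (hs.le_tsum (k + 1) fun j _ => by positivity)
  have h1 : ((k : ℝ) + 1) ≤ 2 ^ (k + 1) := by exact_mod_cast (Nat.lt_two_pow_self (n := k + 1)).le
  have h2 : ρ ^ k ≤ (ρ + 1) ^ (k + 1) :=
    calc ρ ^ k ≤ (ρ + 1) ^ k := by gcongr; linarith
      _ ≤ (ρ + 1) ^ (k + 1) := by gcongr <;> linarith
  rw [Grushin.derivCoeff, abs_mul, abs_of_nonneg (by positivity : (0 : ℝ) ≤ k + 1), mul_pow]
  calc (k + 1) * |a (k + 1)| * ρ ^ k ≤ 2 ^ (k + 1) * |a (k + 1)| * (ρ + 1) ^ (k + 1) := by gcongr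
    _ = _ := by ring

theorem IsEntire.hasDerivAt {a : ℕ → ℝ} (h : IsEntire a) (t : ℝ) :
    HasDerivAt (seriesSum a) (seriesSum (Grushin.derivCoeff a) t) t := by
  set R : ℝ := |t| + 1
  have hR : 0 ≤ R := by positivity
  have hu : Summable fun k : ℕ => |a k| * (k * R ^ (k - 1)) := by
    rw [← summable_nat_add_iff 1]
    refine (h.derivCoeff.abs_summable hR).congr fun k => ?_
    rw [Grushin.derivCoeff, abs_mul, abs_of_nonneg (by positivity : (0 : ℝ) ≤ k + 1)]
    rw [Nat.add_sub_cancel]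
    push_cast
    ring
  have key := hasDerivAt_tsum_of_isPreconnected (g := fun k (s : ℝ) => a k * s ^ k)
    (g' := fun k (s : ℝ) => a k * (k * s ^ (k - 1))) (t := Metric.ball 0 R) (y₀ := 0) (y := t)
    hu Metric.isOpen_ball (convex_ball _ _).isPreconnected
    (fun k s _ => (hasDerivAt_pow k s).const_mul (a k))
    (fun k s hs => by
      have hs' : |s| ≤ R := by simpa using (Metric.mem_ball.1 hs).le
      rw [norm_mul, norm_mul, norm_pow, Real.norm_eq_abs, Real.norm_eq_abs, Real.norm_eq_abs,
        Nat.abs_cast]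
      gcongr)
    (by simp [R]; positivity) (h 0) (by simp [R])
  have hs : Summable fun k : ℕ => a k * (k * t ^ (k - 1)) := by
    refine Summable.of_norm_bounded hu fun k => ?_
    rw [norm_mul, norm_mul, norm_pow, Real.norm_eq_abs, Real.norm_eq_abs, Real.norm_eq_abs,
        Nat.abs_cast]
    gcongr
    simp [R]
  have heq : seriesSum (Grushin.derivCoeff a) t = ∑' k : ℕ, a k * (k * t ^ (k - 1)) := by
    rw [hs.tsum_eq_zero_add, Nat.cast_zero, zero_mul, mul_zero, zero_add]
    refine tsum_congr fun k => ?_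
    rw [Nat.add_sub_cancel, Grushin.derivCoeff]
    push_cast
    ring
  rw [heq]
  exact key

theorem IsEntire.contDiff {a : ℕ → ℝ} (h : IsEntire a) (n : ℕ) : ContDiff ℝ n (seriesSum a) := by
  induction n generalizing a with
  | zero =>
    exact contDiff_zero.2 (continuous_iff_continuousAt.2 fun t => (h.hasDerivAt t).continuousAt)
  | succ n ih =>
    push_cast
    rw [contDiff_succ_iff_deriv]
    refine ⟨fun t => (h.hasDerivAt t).differentiableAt, by simp, ?_⟩
    rw [show deriv (seriesSum a) = seriesSum (Grushin.derivCoeff a) from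
      funext fun t => (h.hasDerivAt t).deriv]
    exact ih h.derivCoeff

/-- Joint continuity in a parameter and the variable, for coefficients that depend continuously on
the parameter and are dominated, locally uniformly in it, by those of an entire series. -/
theorem continuous_seriesSum {c : ℝ → ℕ → ℝ} (hc : ∀ k, Continuous fun lam => c lam k)
    (hA : ∀ Λ : ℝ, ∃ A, IsEntire A ∧ ∀ lam, |lam| ≤ Λ → ∀ k, |c lam k| ≤ A k) :
    Continuous fun q : ℝ × ℝ => seriesSum (c q.1) q.2 := by
  rw [continuous_iff_continuousAt]
  rintro ⟨l, t⟩
  obtain ⟨A, hA, hle⟩ := hA (|l| + 1)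
  have hon : ContinuousOn (fun q : ℝ × ℝ => seriesSum (c q.1) q.2)
      {q | |q.1| < |l| + 1 ∧ |q.2| < |t| + 1} := by
    unfold seriesSum
    refine continuousOn_tsum (u := fun k => A k * (|t| + 1) ^ k)
      (fun k => (((hc k).comp continuous_fst).mul (continuous_snd.pow k)).continuousOn)
      (hA _) fun k q hq => ?_
    rw [norm_mul, norm_pow, Real.norm_eq_abs, Real.norm_eq_abs]
    have h1 := hle q.1 hq.1.le k
    have h2 := (abs_nonneg _).trans h1
    have h3 := hq.2.le
    gcongr
  refine hon.continuousAt (IsOpen.mem_nhds ?_ (by simp))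
  exact (isOpen_lt continuous_fst.abs continuous_const).inter
    (isOpen_lt continuous_snd.abs continuous_const)

/-- The coefficients of the power series `f`, normalised by `f 0 = 1`, that solves
`4 t f'' + 2 d f' = (t ^ γ - lam) f`. The function `x ↦ f (|x|²)` on `ℝ^d` then satisfies
`Δu = (|x| ^ (2 γ) - lam) u`. -/
def radialCoeff (d γ : ℕ) (lam : ℝ) : ℕ → ℝ
  | 0 => 1
  | k + 1 => ((if γ ≤ k then radialCoeff d γ lam (k - γ) else 0) - lam * radialCoeff d γ lam k) /
      (2 * (k + 1) * (2 * k + d))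

theorem continuous_radialCoeff (d γ k : ℕ) : Continuous fun lam => radialCoeff d γ lam k := by
  induction k using Nat.strong_induction_on with
  | _ k ih =>
    cases k with
    | zero => simp only [radialCoeff]; fun_prop
    | succ k =>
      simp only [radialCoeff]
      have h1 := ih k (by omega)
      have h2 := ih (k - γ) (by omega)
      split_ifs <;> fun_prop

/-- At the parameter `-Λ` all signs in the recursion are positive, so the coefficients there
dominate those at every parameter in `[-Λ, Λ]`. -/
theorem abs_radialCoeff_le (d γ : ℕ) {lam Λ : ℝ} (h : |lam| ≤ Λ) (k : ℕ) :
    |radialCoeff d γ lam k| ≤ radialCoeff d γ (-Λ) k := by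
  induction k using Nat.strong_induction_on with
  | _ k ih =>
    cases k with
    | zero => simp [radialCoeff]
    | succ k =>
      simp only [radialCoeff]
      have h1 := ih k (by omega)
      have h2 := ih (k - γ) (by omega)
      rw [abs_div, abs_of_nonneg (by positivity : (0 : ℝ) ≤ 2 * (k + 1) * (2 * k + d))]
      gcongr
      refine (abs_sub _ _).trans ?_
      rw [neg_mul, sub_neg_eq_add, abs_mul]
      have h3 := (abs_nonneg lam).trans h
      gcongr
      split_ifs
      · exact h2
      · simp

theorem isEntire_radialCoeff {d : ℕ} (hd : 1 ≤ d) (γ : ℕ) (lam : ℝ) :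
    IsEntire (radialCoeff d γ lam) := by
  refine IsEntire.of_bounded fun ρ hρ => ?_
  -- Beyond the index `K` the recursion does not increase the maximum of `|a k| ρ ^ k` over the
  -- preceding indices, because its denominator is at least `ρ (ρ ^ γ + |lam|)`.
  obtain ⟨K, hK⟩ := exists_nat_ge (ρ * (ρ ^ γ + |lam|))
  set b : ℕ → ℝ := fun k => |radialCoeff d γ lam k| * ρ ^ k with hb
  have hb0 : ∀ k, 0 ≤ b k := fun k => by positivity
  refine ⟨∑ k ∈ Finset.range (K + 1), b k, fun k => ?_⟩
  set B := ∑ k ∈ Finset.range (K + 1), b k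
  have hB0 : 0 ≤ B := Finset.sum_nonneg fun k _ => hb0 k
  change b k ≤ B
  induction k using Nat.strong_induction_on with
  | _ k ih =>
    rcases le_or_gt k K with hk | hk
    · exact Finset.single_le_sum (f := b) (fun j _ => hb0 j) (Finset.mem_range.2 (by omega))
    · obtain ⟨j, rfl⟩ : ∃ j, k = j + 1 := ⟨k - 1, by omega⟩
      have h1 : |radialCoeff d γ lam j| * ρ ^ j ≤ B := ih j (by omega)
      have h2 : |if γ ≤ j then radialCoeff d γ lam (j - γ) else 0| * ρ ^ j ≤ ρ ^ γ * B := by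
        split_ifs with hj
        · have h3 : |radialCoeff d γ lam (j - γ)| * ρ ^ (j - γ) ≤ B := ih (j - γ) (by omega)
          calc |radialCoeff d γ lam (j - γ)| * ρ ^ j
              = ρ ^ γ * (|radialCoeff d γ lam (j - γ)| * ρ ^ (j - γ)) := by
                rw [← Nat.sub_add_cancel hj, pow_add, Nat.sub_add_cancel hj]; ring
            _ ≤ _ := by gcongr
        · simp; positivity
      have hj : (K : ℝ) ≤ j := by exact_mod_cast Nat.lt_succ_iff.1 hk
      have hd' : (1 : ℝ) ≤ d := by exact_mod_cast hd
      have hj0 : (0 : ℝ) ≤ j := by positivity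
      simp only [hb, radialCoeff]
      rw [abs_div, abs_of_nonneg (by positivity : (0 : ℝ) ≤ 2 * (j + 1) * (2 * j + d)),
        div_mul_eq_mul_div, div_le_iff₀ (by positivity)]
      calc _ ≤ (|if γ ≤ j then radialCoeff d γ lam (j - γ) else 0| +
              |lam| * |radialCoeff d γ lam j|) * ρ ^ (j + 1) := by
            gcongr
            refine (abs_sub _ _).trans ?_
            rw [abs_mul]
        _ = ρ * (|if γ ≤ j then radialCoeff d γ lam (j - γ) else 0| * ρ ^ j +
              |lam| * (|radialCoeff d γ lam j| * ρ ^ j)) := by ring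
        _ ≤ ρ * (ρ ^ γ * B + |lam| * B) := by gcongr
        _ = B * (ρ * (ρ ^ γ + |lam|)) := by ring
        _ ≤ B * (2 * (j + 1) * (2 * j + d)) := by
            refine mul_le_mul_of_nonneg_left ?_ hB0
            nlinarith

/-- The entire solution `f` of `4 t f'' + 2 d f' = (t ^ γ - lam) f` with `f 0 = 1`. -/
def radialSol (d γ : ℕ) (lam : ℝ) : ℝ → ℝ := seriesSum (radialCoeff d γ lam)

/-- The derivative of `radialSol`. -/
def radialSol' (d γ : ℕ) (lam : ℝ) : ℝ → ℝ := seriesSum (derivCoeff (radialCoeff d γ lam))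

/-- The second derivative of `radialSol`. -/
def radialSol'' (d γ : ℕ) (lam : ℝ) : ℝ → ℝ :=
  seriesSum (derivCoeff (derivCoeff (radialCoeff d γ lam)))

theorem hasDerivAt_radialSol {d : ℕ} (hd : 1 ≤ d) (γ : ℕ) (lam t : ℝ) :
    HasDerivAt (radialSol d γ lam) (radialSol' d γ lam t) t :=
  (isEntire_radialCoeff hd γ lam).hasDerivAt t

theorem hasDerivAt_radialSol' {d : ℕ} (hd : 1 ≤ d) (γ : ℕ) (lam t : ℝ) :
    HasDerivAt (radialSol' d γ lam) (radialSol'' d γ lam t) t :=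
  (isEntire_radialCoeff hd γ lam).derivCoeff.hasDerivAt t

theorem contDiff_radialSol {d : ℕ} (hd : 1 ≤ d) (γ : ℕ) (lam : ℝ) :
    ContDiff ℝ ((⊤ : ℕ∞) : WithTop ℕ∞) (radialSol d γ lam) :=
  contDiff_infty.2 fun n => (isEntire_radialCoeff hd γ lam).contDiff n

theorem radialSol_zero (d γ : ℕ) (lam : ℝ) : radialSol d γ lam 0 = 1 := by
  unfold radialSol seriesSum
  rw [tsum_eq_single 0 (fun k hk => by simp [hk])]
  simp [radialCoeff]

theorem continuous_radialSol {d : ℕ} (hd : 1 ≤ d) (γ : ℕ) :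
    Continuous fun q : ℝ × ℝ => radialSol d γ q.1 q.2 :=
  continuous_seriesSum (continuous_radialCoeff d γ) fun Λ =>
    ⟨_, isEntire_radialCoeff hd γ (-Λ), fun _ h k => abs_radialCoeff_le d γ h k⟩

theorem continuous_radialSol' {d : ℕ} (hd : 1 ≤ d) (γ : ℕ) :
    Continuous fun q : ℝ × ℝ => radialSol' d γ q.1 q.2 :=
  continuous_seriesSum (c := fun lam => derivCoeff (radialCoeff d γ lam))
    (fun k => continuous_const.mul (continuous_radialCoeff d γ (k + 1))) fun Λ =>
    ⟨_, (isEntire_radialCoeff hd γ (-Λ)).derivCoeff, fun _ h k => by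
      rw [derivCoeff, derivCoeff, abs_mul, abs_of_nonneg (by positivity : (0 : ℝ) ≤ k + 1)]
      gcongr
      exact abs_radialCoeff_le d γ h _⟩

theorem radialSol_ode {d : ℕ} (hd : 1 ≤ d) (γ : ℕ) (lam t : ℝ) :
    4 * t * radialSol'' d γ lam t + 2 * d * radialSol' d γ lam t =
      (t ^ γ - lam) * radialSol d γ lam t := by
  set a := radialCoeff d γ lam with ha
  have hE : IsEntire a := isEntire_radialCoeff hd γ lam
  have h0 : HasSum (fun k => a k * t ^ k) (radialSol d γ lam t) := (hE t).hasSum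
  have h1 : HasSum (fun k => derivCoeff a k * t ^ k) (radialSol' d γ lam t) :=
    (hE.derivCoeff t).hasSum
  have h2 : HasSum (fun k => derivCoeff (derivCoeff a) k * t ^ k) (radialSol'' d γ lam t) :=
    (hE.derivCoeff.derivCoeff t).hasSum
  have h2' : HasSum (fun k : ℕ => (k * (k + 1) * a (k + 1)) * t ^ k)
      (t * radialSol'' d γ lam t) := by
    rw [← hasSum_nat_add_iff' 1, Finset.range_one, Finset.sum_singleton, Nat.cast_zero, zero_mul,
      zero_mul, zero_mul, sub_zero]
    refine (h2.mul_left t).congr_fun fun k => ?_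
    simp only [derivCoeff]
    push_cast
    ring
  have h0' : HasSum (fun k : ℕ => (if γ ≤ k then a (k - γ) else 0) * t ^ k)
      (t ^ γ * radialSol d γ lam t) := by
    rw [← hasSum_nat_add_iff' γ,
      Finset.sum_eq_zero (fun k hk => by simp [Finset.mem_range.1 hk]), sub_zero]
    refine (h0.mul_left (t ^ γ)).congr_fun fun k => ?_
    rw [if_pos (Nat.le_add_left γ k), Nat.add_sub_cancel, pow_add]
    ring
  have hL := (h2'.mul_left 4).add (h1.mul_left (2 * (d : ℝ)))
  have hR := h0'.sub (h0.mul_left lam)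
  have hLR : (fun k : ℕ => 4 * ((k * (k + 1) * a (k + 1)) * t ^ k) +
      2 * (d : ℝ) * (derivCoeff a k * t ^ k)) =
      fun k : ℕ => (if γ ≤ k then a (k - γ) else 0) * t ^ k - lam * (a k * t ^ k) := by
    funext k
    have hd' : (0 : ℝ) < d := by exact_mod_cast hd
    have hk : a (k + 1) * (2 * (k + 1) * (2 * k + d)) =
        (if γ ≤ k then a (k - γ) else 0) - lam * a k := by
      rw [ha, radialCoeff]
      field_simp
    rw [derivCoeff]
    linear_combination t ^ k * hk
  rw [hLR] at hL
  have := hL.unique hR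
  linear_combination this

/-! ### Shooting for the radial ground state -/

theorem monotoneOn_of_hasDerivAt {s : Set ℝ} (hs : Convex ℝ s) {f f' : ℝ → ℝ}
    (h : ∀ x ∈ s, HasDerivAt f (f' x) x) (h0 : ∀ x ∈ s, 0 ≤ f' x) : MonotoneOn f s :=
  monotoneOn_of_hasDerivWithinAt_nonneg hs (fun x hx => (h x hx).continuousAt.continuousWithinAt)
    (fun x hx => (h x (interior_subset hx)).hasDerivWithinAt) fun x hx => h0 x (interior_subset hx)

theorem antitoneOn_of_hasDerivAt {s : Set ℝ} (hs : Convex ℝ s) {f f' : ℝ → ℝ}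
    (h : ∀ x ∈ s, HasDerivAt f (f' x) x) (h0 : ∀ x ∈ s, f' x ≤ 0) : AntitoneOn f s :=
  antitoneOn_of_hasDerivWithinAt_nonpos hs (fun x hx => (h x hx).continuousAt.continuousWithinAt)
    (fun x hx => (h x (interior_subset hx)).hasDerivWithinAt) fun x hx => h0 x (interior_subset hx)

/-- The radial solution `g(r) = f(r²)` of `g'' + (d - 1) g' / r = (r ^ (2 γ) - lam) g`,
`g(0) = 1`. -/
def profile (d γ : ℕ) (lam r : ℝ) : ℝ := radialSol d γ lam (r ^ 2)

/-- The flux `r ^ (d - 1) g'(r)` of the radial solution, written as `2 r ^ d f'(r²)` so that it is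
regular at `r = 0`. -/
def flux (d γ : ℕ) (lam r : ℝ) : ℝ := 2 * r ^ d * radialSol' d γ lam (r ^ 2)

theorem profile_zero (d γ : ℕ) (lam : ℝ) : profile d γ lam 0 = 1 := by
  simp [profile, radialSol_zero]

theorem flux_zero {d : ℕ} (hd : 1 ≤ d) (γ : ℕ) (lam : ℝ) : flux d γ lam 0 = 0 := by
  simp [flux, show d ≠ 0 by omega]

theorem hasDerivAt_profile_aux {d : ℕ} (hd : 1 ≤ d) (γ : ℕ) (lam r : ℝ) :
    HasDerivAt (profile d γ lam) (2 * r * radialSol' d γ lam (r ^ 2)) r := by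
  have h := (hasDerivAt_radialSol hd γ lam (r ^ 2)).comp r (hasDerivAt_pow 2 r)
  refine h.congr_deriv ?_
  push_cast
  ring

theorem hasDerivAt_profile {d : ℕ} (hd : 1 ≤ d) (γ : ℕ) (lam : ℝ) {r : ℝ} (hr : 0 < r) :
    HasDerivAt (profile d γ lam) (flux d γ lam r / r ^ (d - 1)) r := by
  refine (hasDerivAt_profile_aux hd γ lam r).congr_deriv ?_
  obtain ⟨m, rfl⟩ : ∃ m, d = m + 1 := ⟨d - 1, by omega⟩
  rw [flux, Nat.add_sub_cancel, eq_div_iff (by positivity)]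
  ring

/-- The radial equation in divergence form, valid without singularity at `r = 0`. -/
theorem hasDerivAt_flux {d : ℕ} (hd : 1 ≤ d) (γ : ℕ) (lam r : ℝ) :
    HasDerivAt (flux d γ lam) (r ^ (d - 1) * (r ^ (2 * γ) - lam) * profile d γ lam r) r := by
  have h := ((hasDerivAt_pow d r).const_mul 2).mul
    ((hasDerivAt_radialSol' hd γ lam (r ^ 2)).comp r (hasDerivAt_pow 2 r))
  refine h.congr_deriv ?_
  have ode := radialSol_ode hd γ lam (r ^ 2)
  obtain ⟨m, rfl⟩ : ∃ m, d = m + 1 := ⟨d - 1, by omega⟩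
  rw [profile, pow_mul, mul_assoc (_ ^ (m + 1 - 1)), ← ode, Nat.add_sub_cancel]
  simp only [Function.comp]
  push_cast
  ring

theorem continuous_profile {d : ℕ} (hd : 1 ≤ d) (γ : ℕ) :
    Continuous fun q : ℝ × ℝ => profile d γ q.1 q.2 :=
  (continuous_radialSol hd γ).comp (continuous_fst.prodMk (continuous_snd.pow 2))

theorem continuous_flux {d : ℕ} (hd : 1 ≤ d) (γ : ℕ) :
    Continuous fun q : ℝ × ℝ => flux d γ q.1 q.2 :=
  (continuous_const.mul (continuous_snd.pow d)).mul
    ((continuous_radialSol' hd γ).comp (continuous_fst.prodMk (continuous_snd.pow 2)))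

theorem continuous_profile_right {d : ℕ} (hd : 1 ≤ d) (γ : ℕ) (lam : ℝ) :
    Continuous (profile d γ lam) :=
  (continuous_profile hd γ).comp (continuous_const.prodMk continuous_id)

theorem continuous_profile_left {d : ℕ} (hd : 1 ≤ d) (γ : ℕ) (r : ℝ) :
    Continuous fun lam => profile d γ lam r :=
  (continuous_profile hd γ).comp (continuous_id.prodMk continuous_const)

theorem continuous_flux_left {d : ℕ} (hd : 1 ≤ d) (γ : ℕ) (r : ℝ) :
    Continuous fun lam => flux d γ lam r :=
  (continuous_flux hd γ).comp (continuous_id.prodMk continuous_const)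

/-- A nonnegative radial solution has no zero: at a zero the flux vanishes too, and uniqueness for
the Cauchy problem, in the form of Gronwall's inequality for `flux² + profile²`, propagates this
back to the origin, where the solution is `1`. -/
theorem profile_pos_of_nonneg {d : ℕ} (hd : 1 ≤ d) (γ : ℕ) {lam : ℝ}
    (h : ∀ r, 0 ≤ r → 0 ≤ profile d γ lam r) {r : ℝ} (hr : 0 ≤ r) : 0 < profile d γ lam r := by
  rcases hr.eq_or_lt with rfl | hr
  · rw [profile_zero]; exact one_pos
  refine (h r hr.le).lt_of_ne' fun hg => ?_
  have hp : flux d γ lam r = 0 := by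
    have hmin : IsLocalMin (profile d γ lam) r := by
      filter_upwards [lt_mem_nhds hr] with s hs
      rw [hg]
      exact h s hs.le
    have := hmin.hasDerivAt_eq_zero (hasDerivAt_profile hd γ lam hr)
    rwa [div_eq_zero_iff, or_iff_left (by positivity)] at this
  have hzero : ∀ a ∈ Set.Ioo 0 r, profile d γ lam a = 0 := by
    rintro a ⟨ha, har⟩
    -- The derivative of `E = flux² + profile²` is `2 c · flux · profile` with `|c| ≤ M` on `[a, r]`,
    -- hence `E e^{M s}` is nondecreasing.
    obtain ⟨M, hM⟩ := (isCompact_Icc (a := a) (b := r)).exists_bound_of_continuousOn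
      (f := fun s : ℝ => s ^ (d - 1) * (s ^ (2 * γ) - lam) + 1 / s ^ (d - 1))
      (ContinuousOn.add (by fun_prop) (ContinuousOn.div (by fun_prop) (by fun_prop)
        fun s hs => (pow_pos (ha.trans_le hs.1) _).ne'))
    have hmono := monotoneOn_of_hasDerivAt (convex_Icc a r)
      (f := fun s => (flux d γ lam s ^ 2 + profile d γ lam s ^ 2) * Real.exp (M * s))
      (fun s hs => (((hasDerivAt_flux hd γ lam s).pow 2).add
        ((hasDerivAt_profile hd γ lam (ha.trans_le hs.1)).pow 2)).mul
          ((hasDerivAt_id s).const_mul M).exp) (fun s hs => by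
        have hs0 : 0 < s := ha.trans_le hs.1
        have hb := hM s hs
        rw [Real.norm_eq_abs, abs_le] at hb
        set c := s ^ (d - 1) * (s ^ (2 * γ) - lam) + 1 / s ^ (d - 1) with hc
        set P := flux d γ lam s
        set g := profile d γ lam s
        have key : 0 ≤ 2 * P * g * c + M * (P ^ 2 + g ^ 2) := by
          nlinarith [mul_nonneg (sub_nonneg.2 hb.2) (sq_nonneg (P - g)),
            mul_nonneg (sub_nonneg.2 hb.1) (sq_nonneg (P + g))]
        refine (mul_nonneg key (Real.exp_pos (M * s)).le).trans_eq ?_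
        rw [hc]
        simp only [id, Pi.add_apply, Pi.pow_apply]
        push_cast
        ring)
    have := hmono (Set.left_mem_Icc.2 har.le) (Set.right_mem_Icc.2 har.le) har.le
    simp only [hp, hg] at this
    have h2 : flux d γ lam a ^ 2 + profile d γ lam a ^ 2 ≤ 0 := by
      by_contra! h3
      have := mul_pos h3 (Real.exp_pos (M * a))
      linarith
    nlinarith [sq_nonneg (flux d γ lam a), sq_nonneg (profile d γ lam a)]
  have hclosed : closure (Set.Ioo 0 r) ⊆ {s | profile d γ lam s = 0} :=
    closure_minimal hzero (isClosed_eq (continuous_profile_right hd γ lam) continuous_const)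
  rw [closure_Ioo hr.ne] at hclosed
  have := hclosed (Set.left_mem_Icc.2 hr.le)
  change profile d γ lam 0 = 0 at this
  rw [profile_zero] at this
  exact one_ne_zero this

/-- The parameters for which the solution is positive up to some point beyond the turning point at
which it increases. -/
def tooSmall (d γ : ℕ) : Set ℝ :=
  {lam | ∃ r, 0 < r ∧ lam < r ^ (2 * γ) ∧ 0 < flux d γ lam r ∧
    ∀ s ∈ Set.Icc 0 r, 0 < profile d γ lam s}

/-- The parameters for which the solution takes a negative value. -/
def tooLarge (d γ : ℕ) : Set ℝ := {lam | ∃ r, 0 ≤ r ∧ profile d γ lam r < 0}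

theorem isOpen_tooLarge {d : ℕ} (hd : 1 ≤ d) (γ : ℕ) : IsOpen (tooLarge d γ) := by
  rw [isOpen_iff_mem_nhds]
  rintro lam ⟨r, hr, h⟩
  filter_upwards [(continuous_profile_left hd γ r).continuousAt.eventually_lt_const h] with l hl
  exact ⟨r, hr, hl⟩

theorem isOpen_tooSmall {d : ℕ} (hd : 1 ≤ d) (γ : ℕ) : IsOpen (tooSmall d γ) := by
  rw [isOpen_iff_mem_nhds]
  rintro lam ⟨r, hr, h1, h2, h3⟩
  have h4 : ∀ᶠ l in 𝓝 lam, ∀ s ∈ Set.Icc 0 r, 0 < profile d γ l s :=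
    isCompact_Icc.eventually_forall_of_forall_eventually fun s hs =>
      (continuous_profile hd γ).continuousAt.eventually_const_lt (h3 s hs)
  filter_upwards [gt_mem_nhds h1, (continuous_flux_left hd γ r).continuousAt.eventually_const_lt h2,
    h4] with l hl1 hl2 hl3
  exact ⟨r, hr, hl1, hl2, hl3⟩

theorem mem_tooSmall_of_nonpos {d : ℕ} (hd : 1 ≤ d) (γ : ℕ) {lam : ℝ} (h : lam ≤ 0) :
    lam ∈ tooSmall d γ := by
  have h0 : ∀ᶠ r in 𝓝 (0 : ℝ), 0 < profile d γ lam r :=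
    (continuous_profile_right hd γ lam).continuousAt.eventually_const_lt
      (by rw [profile_zero]; exact one_pos)
  obtain ⟨ε, hε, hpos⟩ := Metric.eventually_nhds_iff.1 h0
  have hpos' : ∀ s ∈ Set.Icc 0 (ε / 2), 0 < profile d γ lam s := fun s hs => hpos (by
    rw [Real.dist_eq, sub_zero, abs_of_nonneg hs.1]
    linarith [hs.2])
  refine ⟨ε / 2, by positivity, h.trans_lt (by positivity), ?_, hpos'⟩
  have hmono : StrictMonoOn (flux d γ lam) (Set.Icc 0 (ε / 2)) := by
    refine strictMonoOn_of_hasDerivWithinAt_pos (convex_Icc _ _)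
      (fun x _ => (hasDerivAt_flux hd γ lam x).continuousAt.continuousWithinAt)
      (fun x _ => (hasDerivAt_flux hd γ lam x).hasDerivWithinAt) fun x hx => ?_
    have hg := hpos' x (interior_subset hx)
    rw [interior_Icc] at hx
    have hx0 := hx.1
    have : 0 < x ^ (2 * γ) - lam := by linarith [pow_pos hx0 (2 * γ)]
    positivity
  have := hmono (Set.left_mem_Icc.2 (by positivity)) (Set.right_mem_Icc.2 (by positivity))
    (half_pos hε)
  rwa [flux_zero hd] at this

/-- Beyond the turning point the flux of a positive solution is nondecreasing, so a solution that
increases there keeps increasing and never vanishes. -/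
theorem disjoint_tooSmall_tooLarge {d : ℕ} (hd : 1 ≤ d) (γ : ℕ) :
    Disjoint (tooSmall d γ) (tooLarge d γ) := by
  rw [Set.disjoint_left]
  rintro lam ⟨r, hr, hlam, hp, hg⟩ ⟨t, ht, hgt⟩
  have hrt : r < t := by
    by_contra! htr
    exact (hg t ⟨ht, htr⟩).not_gt hgt
  -- The first zero after `r` would follow an interval on which the solution is nondecreasing.
  set S : Set ℝ := Set.Ici r ∩ {s | profile d γ lam s ≤ 0}
  have hScl : IsClosed S :=
    isClosed_Ici.inter (isClosed_le (continuous_profile_right hd γ lam) continuous_const)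
  have hSbdd : BddBelow S := ⟨r, fun s hs => hs.1⟩
  have hmem : sInf S ∈ S := hScl.csInf_mem ⟨t, hrt.le, hgt.le⟩ hSbdd
  set u := sInf S
  have hru : r ≤ u := hmem.1
  have hpos : ∀ s ∈ Set.Ico r u, 0 < profile d γ lam s := fun s hs => by
    by_contra! h
    exact (csInf_le hSbdd ⟨hs.1, h⟩).not_gt hs.2
  have hV : ∀ s ∈ Set.Icc r u, 0 ≤ s ^ (2 * γ) - lam := fun s hs => by
    have : r ^ (2 * γ) ≤ s ^ (2 * γ) := pow_le_pow_left₀ hr.le hs.1 _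
    linarith
  have hflux : MonotoneOn (flux d γ lam) (Set.Icc r u) :=
    monotoneOn_of_hasDerivWithinAt_nonneg (convex_Icc _ _)
      (fun x _ => (hasDerivAt_flux hd γ lam x).continuousAt.continuousWithinAt)
      (fun x _ => (hasDerivAt_flux hd γ lam x).hasDerivWithinAt) fun x hx => by
        have h1 := hV x (interior_subset hx)
        rw [interior_Icc] at hx
        have h2 := hpos x ⟨hx.1.le, hx.2⟩
        have h3 : 0 < x := hr.trans hx.1
        positivity
  have hprof : MonotoneOn (profile d γ lam) (Set.Icc r u) :=
    monotoneOn_of_hasDerivAt (convex_Icc _ _)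
      (fun x hx => hasDerivAt_profile hd γ lam (hr.trans_le hx.1)) fun x hx => by
        have h1 := hflux (Set.left_mem_Icc.2 hru) hx hx.1
        have h2 : 0 < x := hr.trans_le hx.1
        have h3 : 0 ≤ flux d γ lam x := hp.le.trans h1
        positivity
  have h1 := hprof (Set.left_mem_Icc.2 hru) (Set.right_mem_Icc.2 hru) hru
  have h2 := hg r ⟨hr.le, le_rfl⟩
  have h3 : profile d γ lam u ≤ 0 := hmem.2
  linarith

/-- If `lam = 1 + μ` with `μ` large, then the flux accumulated on `[0, 1/2]` is so negative that the
solution has to vanish before `r = 1`. -/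
theorem tooLarge_nonempty {d : ℕ} (hd : 1 ≤ d) (γ : ℕ) : (tooLarge d γ).Nonempty := by
  -- This value makes `flux (1/2) ≤ -4 g(1/2)`, more than enough for `g` to lose the amount `g(1/2)`
  -- on an interval of length `1/2`.
  set μ : ℝ := d * 2 ^ (d + 2) with hμ
  refine ⟨1 + μ, ?_⟩
  by_contra hcon
  have hnn : ∀ r, 0 ≤ r → 0 ≤ profile d γ (1 + μ) r := fun r hr => by
    by_contra! h
    exact hcon ⟨r, hr, h⟩
  have hpos : ∀ r, 0 ≤ r → 0 < profile d γ (1 + μ) r := fun r hr =>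
    profile_pos_of_nonneg hd γ hnn hr
  have hd' : (0 : ℝ) < d := by exact_mod_cast hd
  have hμ0 : 0 < μ := by positivity
  have hV : ∀ s ∈ Set.Icc (0 : ℝ) 1, s ^ (2 * γ) - (1 + μ) ≤ -μ := fun s hs => by
    have := pow_le_one₀ (n := 2 * γ) hs.1 hs.2
    linarith
  have hflux : AntitoneOn (flux d γ (1 + μ)) (Set.Icc 0 1) :=
    antitoneOn_of_hasDerivAt (convex_Icc _ _) (fun x _ => hasDerivAt_flux hd γ _ x) fun x hx => by
      have h1 := hV x hx
      have h2 := hpos x hx.1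
      have h3 := pow_nonneg hx.1 (d - 1)
      exact mul_nonpos_of_nonpos_of_nonneg
        (mul_nonpos_of_nonneg_of_nonpos h3 (by linarith)) h2.le
  have hprof : AntitoneOn (profile d γ (1 + μ)) (Set.Icc 0 1) := by
    refine antitoneOn_of_hasDerivWithinAt_nonpos (convex_Icc _ _)
      (continuous_profile_right hd γ _).continuousOn
      (f' := fun x => flux d γ (1 + μ) x / x ^ (d - 1))
      (fun x hx => ?_) fun x hx => ?_
    · rw [interior_Icc] at hx
      exact (hasDerivAt_profile hd γ _ hx.1).hasDerivWithinAt
    · rw [interior_Icc] at hx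
      have h1 := hflux (Set.left_mem_Icc.2 zero_le_one) ⟨hx.1.le, hx.2.le⟩ hx.1.le
      rw [flux_zero hd] at h1
      exact div_nonpos_of_nonpos_of_nonneg h1 (pow_nonneg hx.1.le _)
  set G := profile d γ (1 + μ) (1 / 2) with hG
  have hG0 : 0 < G := hpos _ (by norm_num)
  have hhalf : flux d γ (1 + μ) (1 / 2) ≤ -(2 * 2 * G) := by
    have hanti : AntitoneOn (fun r => flux d γ (1 + μ) r + μ * G / d * r ^ d)
        (Set.Icc 0 (1 / 2)) :=
      antitoneOn_of_hasDerivAt (convex_Icc _ _) (fun x _ =>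
        (hasDerivAt_flux hd γ _ x).add ((hasDerivAt_pow d x).const_mul _)) fun x hx => by
          have hx1 : x ∈ Set.Icc (0 : ℝ) 1 := ⟨hx.1, hx.2.trans (by norm_num)⟩
          have h1 := hV x hx1
          have h2 : G ≤ profile d γ (1 + μ) x :=
            hprof hx1 ⟨by norm_num, by norm_num⟩ hx.2
          have h3 := pow_nonneg hx.1 (d - 1)
          have h4 : (x ^ (2 * γ) - (1 + μ)) * profile d γ (1 + μ) x ≤ -μ * G := by
            nlinarith
          have h5 := mul_le_mul_of_nonneg_left h4 h3
          have h6 : μ * G / d * (d * x ^ (d - 1)) = x ^ (d - 1) * (μ * G) := by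
            field_simp
          rw [h6]
          linarith
    have h1 := hanti (Set.left_mem_Icc.2 (by norm_num)) (Set.right_mem_Icc.2 (by norm_num))
      (by norm_num)
    simp only [flux_zero hd, zero_pow (show d ≠ 0 by omega), mul_zero, add_zero] at h1
    have h2 : μ * G / d * (1 / 2) ^ d = 2 * 2 * G := by
      rw [hμ, one_div, inv_pow, pow_add]
      field_simp
    linarith
  have hanti : AntitoneOn (fun r => profile d γ (1 + μ) r + 2 * 2 * G * r) (Set.Icc (1 / 2) 1) :=
    antitoneOn_of_hasDerivAt (convex_Icc _ _) (fun x hx =>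
      (hasDerivAt_profile hd γ _ (lt_of_lt_of_le (by norm_num) hx.1)).add
        ((hasDerivAt_id x).const_mul (2 * 2 * G))) fun x hx => by
      have hx0 : 0 < x := lt_of_lt_of_le (by norm_num) hx.1
      have h1 := hflux ⟨by norm_num, by norm_num⟩ ⟨hx0.le, hx.2⟩ hx.1
      have h2 := pow_le_one₀ (n := d - 1) hx0.le hx.2
      have h3 : flux d γ (1 + μ) x / x ^ (d - 1) ≤ -(2 * 2 * G) := by
        rw [div_le_iff₀ (by positivity)]
        nlinarith
      linarith
  have h1 := hanti (Set.left_mem_Icc.2 (by norm_num)) (Set.right_mem_Icc.2 (by norm_num))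
    (by norm_num)
  have h2 := hpos 1 zero_le_one
  simp only [← hG] at h1
  linarith

/-- The shooting argument: some positive parameter is neither too small nor too large. -/
theorem exists_critical {d : ℕ} (hd : 1 ≤ d) (γ : ℕ) :
    ∃ lam : ℝ, 0 < lam ∧ (∀ r, 0 ≤ r → 0 < profile d γ lam r) ∧
      ∀ r, 0 < r → lam < r ^ (2 * γ) → flux d γ lam r ≤ 0 := by
  obtain ⟨lam, hlam⟩ : ∃ lam, lam ∉ tooSmall d γ ∪ tooLarge d γ := by
    by_contra! hcon
    obtain ⟨x, -, hx⟩ := isPreconnected_univ _ _ (isOpen_tooSmall hd γ) (isOpen_tooLarge hd γ)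
      (fun x _ => hcon x) ⟨0, trivial, mem_tooSmall_of_nonpos hd γ le_rfl⟩
      ((tooLarge_nonempty hd γ).mono fun x hx => ⟨trivial, hx⟩)
    exact Set.disjoint_left.1 (disjoint_tooSmall_tooLarge hd γ) hx.1 hx.2
  rw [Set.mem_union, not_or] at hlam
  obtain ⟨hS, hL⟩ := hlam
  have hpos : ∀ r, 0 ≤ r → 0 < profile d γ lam r := fun r hr =>
    profile_pos_of_nonneg hd γ (fun s hs => by
      by_contra! h
      exact hL ⟨s, hs, h⟩) hr
  refine ⟨lam, ?_, hpos, fun r hr hlr => ?_⟩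
  · by_contra! h
    exact hS (mem_tooSmall_of_nonpos hd γ h)
  · by_contra! h
    exact hS ⟨r, hr, hlr, h, fun s hs => hpos s hs.1⟩

/-- The estimate `g'² ≥ (r ^ (2 γ) - lam) g²` beyond the turning point for a positive nonincreasing
solution, multiplied by `r ^ (2 (d - 1))`. -/
theorem flux_sq_ge {d : ℕ} (hd : 1 ≤ d) {γ : ℕ} {lam T : ℝ} (hT : 0 < T)
    (hlam : ∀ r, T ≤ r → lam < r ^ (2 * γ)) (hpos : ∀ r, 0 ≤ r → 0 < profile d γ lam r)
    (hflux : ∀ r, T ≤ r → flux d γ lam r ≤ 0) {r : ℝ} (hr : T ≤ r) :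
    r ^ (2 * (d - 1)) * (r ^ (2 * γ) - lam) * profile d γ lam r ^ 2 ≤ flux d γ lam r ^ 2 := by
  have hanti : AntitoneOn (fun s => flux d γ lam s ^ 2 -
      s ^ (2 * (d - 1)) * (s ^ (2 * γ) - lam) * profile d γ lam s ^ 2) (Set.Ici T) :=
    antitoneOn_of_hasDerivAt (convex_Ici T) (fun s hs =>
      ((hasDerivAt_flux hd γ lam s).pow 2).sub
        (((hasDerivAt_pow (2 * (d - 1)) s).mul ((hasDerivAt_pow (2 * γ) s).sub_const lam)).mul
          ((hasDerivAt_profile hd γ lam (hT.trans_le hs)).pow 2))) fun s hs => by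
      have hs0 : 0 < s := hT.trans_le hs
      have h1 : 0 < s ^ (2 * γ) - lam := sub_pos.2 (hlam s hs)
      have h2 : 0 ≤ ((2 * (d - 1) : ℕ) * s ^ (2 * (d - 1) - 1) * (s ^ (2 * γ) - lam) +
          s ^ (2 * (d - 1)) * ((2 * γ : ℕ) * s ^ (2 * γ - 1))) * profile d γ lam s ^ 2 := by
        positivity
      refine le_of_eq_of_le ?_ (neg_nonpos.2 h2)
      simp only [Pi.mul_apply]
      rw [two_mul (d - 1), pow_add]
      field_simp
      push_cast
      ring
  -- Otherwise the difference stays below `-ε` from `r` on, so that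
  -- `flux'² = (s ^ (2γ) - lam) · s ^ (2(d-1)) (s ^ (2γ) - lam) g²` is at least `κ²`; then the flux
  -- grows at least linearly and becomes positive.
  by_contra! hcon
  set ε := r ^ (2 * (d - 1)) * (r ^ (2 * γ) - lam) * profile d γ lam r ^ 2 - flux d γ lam r ^ 2
    with hε
  have hε0 : 0 < ε := sub_pos.2 hcon
  have hV0 : 0 < r ^ (2 * γ) - lam := sub_pos.2 (hlam r hr)
  set κ := √((r ^ (2 * γ) - lam) * ε) with hκ
  have hκ0 : 0 < κ := Real.sqrt_pos.2 (mul_pos hV0 hε0)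
  have hmono : MonotoneOn (fun s => flux d γ lam s - κ * s) (Set.Ici r) :=
    monotoneOn_of_hasDerivAt (convex_Ici r) (fun s _ =>
      (hasDerivAt_flux hd γ lam s).sub ((hasDerivAt_id s).const_mul κ)) fun s hs => by
      have hs' : r ≤ s := hs
      have hr0 : 0 < r := hT.trans_le hr
      have hs0 : 0 < s := hr0.trans_le hs'
      have h1 := hanti hr (hr.trans hs') hs'
      have hVs : 0 < s ^ (2 * γ) - lam := sub_pos.2 (hlam s (hr.trans hs'))
      have hVV : r ^ (2 * γ) - lam ≤ s ^ (2 * γ) - lam :=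
        sub_le_sub_right (pow_le_pow_left₀ hr0.le hs' _) _
      have hg := hpos s hs0.le
      have h2 : ε ≤ s ^ (2 * (d - 1)) * (s ^ (2 * γ) - lam) * profile d γ lam s ^ 2 := by
        have := sq_nonneg (flux d γ lam s)
        simp only at h1
        linarith
      rw [mul_one, sub_nonneg, hκ, Real.sqrt_le_iff]
      refine ⟨by positivity, ?_⟩
      calc (r ^ (2 * γ) - lam) * ε ≤ (s ^ (2 * γ) - lam) *
            (s ^ (2 * (d - 1)) * (s ^ (2 * γ) - lam) * profile d γ lam s ^ 2) := by gcongr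
        _ = _ := by ring
  have hfr := hflux r hr
  set s := r + (1 - flux d γ lam r) / κ with hs
  have hrs : r ≤ s := by
    rw [hs, le_add_iff_nonneg_right]
    exact div_nonneg (by linarith) hκ0.le
  have h1 := hmono (Set.mem_Ici.2 le_rfl) (Set.mem_Ici.2 hrs) hrs
  have h2 := hflux s (hr.trans hrs)
  have h3 : κ * s = κ * r + (1 - flux d γ lam r) := by
    rw [hs]; field_simp
  simp only at h1
  linarith

/-- The radial ground state of `-Δ + |x| ^ (2 γ)`, with its decay `e^{-κ r^{γ+1}}`. -/
theorem exists_ground_state {d γ : ℕ} (hd : 1 ≤ d) (hγ : 1 ≤ γ) :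
    ∃ lam C κ : ℝ, 0 < lam ∧ 0 < κ ∧ ∀ r, 0 ≤ r → 0 < profile d γ lam r ∧
      profile d γ lam r ≤ C * Real.exp (-(κ * r ^ (γ + 1))) := by
  obtain ⟨lam, hlam, hpos, hflux⟩ := exists_critical hd γ
  set T := 1 + 2 * lam with hT
  have hT0 : 0 < T := by positivity
  have hlarge : ∀ r, T ≤ r → 2 * lam ≤ r ^ (2 * γ) := fun r hr => by
    have h1 : 1 ≤ r := by linarith
    have h2 : r ≤ r ^ (2 * γ) := le_self_pow₀ h1 (by omega)
    linarith
  -- For `r ≥ T` the potential satisfies `r ^ (2γ) - lam ≥ r ^ (2γ) / 4`, which gives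
  -- `g' ≤ -(r ^ γ / 2) g`; this `κ` makes the derivative of `κ r ^ (γ + 1)` equal to `r ^ γ / 2`.
  set κ : ℝ := 1 / (2 * (γ + 1)) with hκ
  have hκ0 : 0 < κ := by positivity
  have hanti : AntitoneOn (fun r => profile d γ lam r * Real.exp (κ * r ^ (γ + 1)))
      (Set.Ici T) :=
    antitoneOn_of_hasDerivAt (convex_Ici T) (fun r hr =>
      (hasDerivAt_profile hd γ lam (hT0.trans_le hr)).mul
        ((hasDerivAt_pow (γ + 1) r).const_mul κ).exp) fun r hr => by
      have hr' : T ≤ r := hr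
      have hr0 : 0 < r := hT0.trans_le hr'
      have h1 := flux_sq_ge hd hT0 (fun s hs => by linarith [hlarge s hs]) hpos
        (fun s hs => hflux s (hT0.trans_le hs) (by linarith [hlarge s hs])) hr'
      have h2 := hflux r hr0 (by linarith [hlarge r hr'])
      have hg := hpos r hr0.le
      have h3 : r ^ (d - 1) * r ^ γ * profile d γ lam r / 2 ≤ -flux d γ lam r := by
        refine (sq_le_sq₀ (by positivity) (by linarith)).1 ?_
        rw [neg_sq]
        refine le_trans ?_ h1
        calc (r ^ (d - 1) * r ^ γ * profile d γ lam r / 2) ^ 2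
            = r ^ (2 * (d - 1)) * (r ^ (2 * γ) / 4) * profile d γ lam r ^ 2 := by ring
          _ ≤ _ := by
            gcongr
            linarith [hlarge r hr', pow_pos hr0 (2 * γ)]
      have h4 : flux d γ lam r / r ^ (d - 1) ≤ -(r ^ γ * profile d γ lam r / 2) := by
        rw [div_le_iff₀ (by positivity)]
        linarith
      have h5 : κ * ((γ + 1 : ℕ) * r ^ γ) = r ^ γ / 2 := by
        rw [hκ]; push_cast; field_simp
      rw [Nat.add_sub_cancel, h5]
      have h6 := Real.exp_pos (κ * r ^ (γ + 1))
      nlinarith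
  have hcont : Continuous fun r => profile d γ lam r * Real.exp (κ * r ^ (γ + 1)) :=
    (continuous_profile_right hd γ lam).mul (by fun_prop)
  obtain ⟨C, hC⟩ := (isCompact_Icc (a := 0) (b := T)).exists_bound_of_continuousOn
    hcont.continuousOn
  have hall : ∀ r, 0 ≤ r → profile d γ lam r * Real.exp (κ * r ^ (γ + 1)) ≤ C := fun r hr => by
    rcases le_total r T with h | h
    · exact (le_abs_self _).trans (hC r ⟨hr, h⟩)
    · exact (hanti (Set.mem_Ici.2 le_rfl) h h).trans
        ((le_abs_self _).trans (hC T ⟨hT0.le, le_rfl⟩))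
  refine ⟨lam, C, κ, hlam, hκ0, fun r hr => ⟨hpos r hr, ?_⟩⟩
  rw [Real.exp_neg, ← div_eq_mul_inv, le_div_iff₀ (Real.exp_pos _)]
  exact hall r hr

/-! ### Green's formula on the cylinder -/

variable {d : ℕ}

instance isAddHaarMeasure_torus : (volume : Measure (Torus d)).IsAddHaarMeasure :=
  inferInstanceAs (Measure.pi fun _ : Fin d =>
    (volume : Measure (AddCircle (2 * Real.pi)))).IsAddHaarMeasure

instance isAddHaarMeasure_cylinder :
    (volume : Measure (Cylinder d)).IsAddHaarMeasure :=
  Measure.prod.instIsAddHaarMeasure _ _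

/-- The covering map `ℝ^d × ℝ^d → ℝ^d × 𝕋^d`. -/
def proj (p : Space d × Space d) : Cylinder d := (p.1, toTorus p.2)

theorem proj_add (p q : Space d × Space d) : proj (p + q) = proj p + proj q := by
  ext i <;> simp [proj, toTorus]

theorem proj_zero : proj (0 : Space d × Space d) = 0 := by
  ext i <;> simp [proj, toTorus]

theorem isOpenQuotientMap_proj : IsOpenQuotientMap (proj (d := d)) := by
  have h1 : IsOpenQuotientMap (toTorus (d := d)) := by
    have h2 : IsOpenQuotientMap fun (v : Fin d → ℝ) (i : Fin d) =>
        ((v i : ℝ) : AddCircle (2 * Real.pi)) :=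
      IsOpenQuotientMap.piMap fun _ => QuotientAddGroup.isOpenQuotientMap_mk
    exact h2.comp (EuclideanSpace.equiv (Fin d) ℝ).toHomeomorph.isOpenQuotientMap
  exact IsOpenQuotientMap.id.prodMap h1

theorem continuous_proj : Continuous (proj (d := d)) := isOpenQuotientMap_proj.continuous

/-- The function `F` on the cylinder is smooth, expressed through its periodic lift to
`ℝ^d × ℝ^d` as in `IsTestFunction`. -/
def SmoothLift (F : Cylinder d → ℂ) : Prop :=
  ContDiff ℝ ((⊤ : ℕ∞) : WithTop ℕ∞) fun p : Space d × Space d => F (proj p)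

/-- The derivative of `F` at `z` in the direction `w`, along the one-parameter group
`t ↦ z + proj (t • w)`. -/
def dirDeriv (w : Space d × Space d) (F : Cylinder d → ℂ) (z : Cylinder d) : ℂ :=
  deriv (fun t : ℝ => F (z + proj (t • w))) 0

namespace SmoothLift

variable {F G : Cylinder d → ℂ}

theorem continuous (hF : SmoothLift F) : Continuous F :=
  isOpenQuotientMap_proj.isQuotientMap.continuous_iff.2 (ContDiff.continuous hF)

theorem mul (hF : SmoothLift F) (hG : SmoothLift G) : SmoothLift fun z => F z * G z :=
  ContDiff.mul hF hG

theorem sub (hF : SmoothLift F) (hG : SmoothLift G) : SmoothLift fun z => F z - G z :=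
  ContDiff.sub hF hG

theorem dirDeriv_proj (hF : SmoothLift F) (w p : Space d × Space d) :
    dirDeriv w F (proj p) = fderiv ℝ (fun p => F (proj p)) p w := by
  have h : DifferentiableAt ℝ (fun p => F (proj p)) p :=
    (ContDiff.differentiable hF (by simp)) p
  rw [← h.lineDeriv_eq_fderiv, lineDeriv, dirDeriv]
  simp only [proj_add]

theorem dirDeriv (hF : SmoothLift F) (w : Space d × Space d) : SmoothLift (dirDeriv w F) := by
  unfold SmoothLift
  simp only [hF.dirDeriv_proj]
  exact (ContDiff.fderiv_right (m := ((⊤ : ℕ∞) : WithTop ℕ∞)) hF (by simp)).clm_apply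
    contDiff_const

theorem hasDerivAt (hF : SmoothLift F) (w : Space d × Space d) (z : Cylinder d) (t : ℝ) :
    HasDerivAt (fun s : ℝ => F (z + proj (s • w)))
      (Grushin.dirDeriv w F (z + proj (t • w))) t := by
  obtain ⟨p, rfl⟩ := isOpenQuotientMap_proj.surjective z
  simp only [← proj_add]
  rw [hF.dirDeriv_proj]
  have h := (ContDiff.differentiable hF (by simp) (p + t • w)).hasFDerivAt
  have hl : HasDerivAt (fun s : ℝ => p + s • w) w t := by
    simpa using ((hasDerivAt_id t).smul_const w).const_add p
  exact h.comp_hasDerivAt t hl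

theorem hasDerivAt_zero (hF : SmoothLift F) (w : Space d × Space d) (z : Cylinder d) :
    HasDerivAt (fun s : ℝ => F (z + proj (s • w))) (Grushin.dirDeriv w F z) 0 := by
  simpa [proj_zero] using hF.hasDerivAt w z 0

theorem dirDeriv_mul (hF : SmoothLift F) (hG : SmoothLift G) (w : Space d × Space d)
    (z : Cylinder d) : Grushin.dirDeriv w (fun z => F z * G z) z =
      Grushin.dirDeriv w F z * G z + F z * Grushin.dirDeriv w G z := by
  have := ((hF.hasDerivAt_zero w z).mul (hG.hasDerivAt_zero w z)).deriv
  rw [zero_smul, proj_zero, add_zero] at this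
  exact this

theorem dirDeriv_sub (hF : SmoothLift F) (hG : SmoothLift G) (w : Space d × Space d)
    (z : Cylinder d) : Grushin.dirDeriv w (fun z => F z - G z) z =
      Grushin.dirDeriv w F z - Grushin.dirDeriv w G z :=
  ((hF.hasDerivAt_zero w z).sub (hG.hasDerivAt_zero w z)).deriv

end SmoothLift

theorem HasCompactSupport.dirDeriv {F : Cylinder d → ℂ} (hF : HasCompactSupport F)
    (w : Space d × Space d) : HasCompactSupport (dirDeriv w F) := by
  refine hF.mono' fun z hz => ?_
  by_contra hzF
  refine hz ?_
  have h0 : Tendsto (fun t : ℝ => z + proj (t • w)) (𝓝 0) (𝓝 z) := by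
    have hc : Continuous fun t : ℝ => z + proj (t • w) :=
      continuous_const.add (continuous_proj.comp (continuous_id.smul continuous_const))
    have := hc.tendsto 0
    rwa [zero_smul, proj_zero, add_zero] at this
  have h1 : (fun t : ℝ => F (z + proj (t • w))) =ᶠ[𝓝 0] fun _ => 0 :=
    h0.eventually (notMem_tsupport_iff_eventuallyEq.1 hzF)
  rw [Grushin.dirDeriv, h1.deriv_eq, deriv_const]

/-- The integral over `z` of `F (z + proj w) - F z = ∫₀¹ dirDeriv w F (z + proj (t • w)) dt`
vanishes, and by Fubini and translation invariance it equals the integral of `dirDeriv w F`. -/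
theorem integral_dirDeriv_eq_zero {F : Cylinder d → ℂ} (hF : SmoothLift F)
    (hc : HasCompactSupport F) (w : Space d × Space d) : ∫ z, dirDeriv w F z = 0 := by
  have hFi : Integrable F := hF.continuous.integrable_of_hasCompactSupport hc
  have hcont : Continuous (dirDeriv w F) := (hF.dirDeriv w).continuous
  have hi : Integrable (dirDeriv w F) :=
    hcont.integrable_of_hasCompactSupport (HasCompactSupport.dirDeriv hc w)
  have hline : Continuous fun q : Cylinder d × ℝ => q.1 + proj (q.2 • w) :=
    continuous_fst.add (continuous_proj.comp (continuous_snd.smul continuous_const))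
  have hftc : ∀ z, ∫ t in Set.Ioc (0 : ℝ) 1, dirDeriv w F (z + proj (t • w)) =
      F (z + proj w) - F z := fun z => by
    have h := intervalIntegral.integral_eq_sub_of_hasDerivAt (a := 0) (b := 1)
      (fun t _ => hF.hasDerivAt w z t)
      ((hcont.comp (hline.comp (continuous_const.prodMk continuous_id))).intervalIntegrable 0 1)
    rw [intervalIntegral.integral_of_le zero_le_one] at h
    simpa [proj_zero] using h
  have hprod : Integrable (fun q : Cylinder d × ℝ => dirDeriv w F (q.1 + proj (q.2 • w)))
      ((volume : Measure (Cylinder d)).prod (volume.restrict (Set.Ioc (0 : ℝ) 1))) := by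
    have hmeas : AEStronglyMeasurable
        (fun q : Cylinder d × ℝ => dirDeriv w F (q.1 + proj (q.2 • w)))
        ((volume : Measure (Cylinder d)).prod (volume.restrict (Set.Ioc (0 : ℝ) 1))) :=
      Continuous.aestronglyMeasurable (hcont.comp hline)
    refine (integrable_prod_iff' hmeas).2
      ⟨ae_of_all _ fun t => hi.comp_add_right (proj (t • w)), ?_⟩
    have : (fun t : ℝ => ∫ z, ‖dirDeriv w F (z + proj (t • w))‖) =
        fun _ => ∫ z, ‖dirDeriv w F z‖ :=
      funext fun t => integral_add_right_eq_self (fun z => ‖dirDeriv w F z‖) _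
    rw [this]
    exact integrable_const _
  have hswap := integral_integral_swap (f := fun z t => dirDeriv w F (z + proj (t • w))) hprod
  simp only [hftc] at hswap
  rw [integral_sub (hFi.comp_add_right (proj w)) hFi, integral_add_right_eq_self F,
    sub_self] at hswap
  have : (fun t : ℝ => ∫ z, dirDeriv w F (z + proj (t • w))) = fun _ => ∫ z, dirDeriv w F z :=
    funext fun t => integral_add_right_eq_self (dirDeriv w F) _
  rw [this] at hswap
  simpa using hswap.symm

/-- Green's formula in one direction `w`, with a weight `ρ` that is constant along `w`: the
integrands differ by the derivative of `ρ (u ∂φ - φ ∂u)`. -/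
theorem integral_mul_dirDeriv_dirDeriv {ρ u φ : Cylinder d → ℂ} (hρ : SmoothLift ρ)
    (hu : SmoothLift u) (hφ : SmoothLift φ) (hc : HasCompactSupport φ) {w : Space d × Space d}
    (hw : ∀ z, dirDeriv w ρ z = 0) :
    ∫ z, ρ z * (u z * dirDeriv w (dirDeriv w φ) z) =
      ∫ z, ρ z * (φ z * dirDeriv w (dirDeriv w u) z) := by
  have hc' := HasCompactSupport.dirDeriv hc w
  have hc'' := HasCompactSupport.dirDeriv hc' w
  have hW : SmoothLift fun z => u z * dirDeriv w φ z - φ z * dirDeriv w u z :=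
    (hu.mul (hφ.dirDeriv w)).sub (hφ.mul (hu.dirDeriv w))
  have h0 := integral_dirDeriv_eq_zero (hρ.mul hW)
    (HasCompactSupport.mul_left (HasCompactSupport.sub hc'.mul_left hc.mul_right)) w
  have hcalc : ∀ z, dirDeriv w
      (fun z => ρ z * (u z * dirDeriv w φ z - φ z * dirDeriv w u z)) z =
      ρ z * (u z * dirDeriv w (dirDeriv w φ) z) - ρ z * (φ z * dirDeriv w (dirDeriv w u) z) :=
    fun z => by
      rw [hρ.dirDeriv_mul hW, hw, (hu.mul (hφ.dirDeriv w)).dirDeriv_sub (hφ.mul (hu.dirDeriv w)),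
        hu.dirDeriv_mul (hφ.dirDeriv w), hφ.dirDeriv_mul (hu.dirDeriv w)]
      ring
  simp only [hcalc] at h0
  rw [integral_sub] at h0
  · exact sub_eq_zero.1 h0
  · exact (hρ.mul (hu.mul ((hφ.dirDeriv w).dirDeriv w))).continuous.integrable_of_hasCompactSupport
      (HasCompactSupport.mul_left hc''.mul_left)
  · exact (hρ.mul (hφ.mul ((hu.dirDeriv w).dirDeriv w))).continuous.integrable_of_hasCompactSupport
      (HasCompactSupport.mul_left hc.mul_right)

theorem laplacian_eq_sum {E : Type*} [NormedAddCommGroup E] [NormedSpace ℝ E] {h : Space d → E}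
    (hh : ContDiff ℝ 2 h) (x : Space d) :
    Laplacian.laplacian h x = ∑ i : Fin d,
      fderiv ℝ (fun y => fderiv ℝ h y (EuclideanSpace.single i 1)) x
        (EuclideanSpace.single i 1) := by
  rw [InnerProductSpace.laplacian_eq_iteratedFDeriv_orthonormalBasis h
    (EuclideanSpace.basisFun (Fin d) ℝ)]
  refine Finset.sum_congr rfl fun i _ => ?_
  rw [iteratedFDeriv_two_apply]
  have h1 : DifferentiableAt ℝ (fderiv ℝ h) x :=
    (hh.fderiv_right (m := 1) (by norm_num)).differentiable (by norm_num) x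
  rw [fderiv_clm_apply h1 (differentiableAt_const _)]
  simp

/-- The Laplacian of `F` along a linear slice of the cylinder as a sum of second directional
derivatives; the cases `L = inl` and `L = inr` are the Laplacians in `x` and in `y`. -/
theorem SmoothLift.laplacian_slice {F : Cylinder d → ℂ} (hF : SmoothLift F)
    (L : Space d →L[ℝ] Space d × Space d) (z : Cylinder d) (x : Space d) :
    Laplacian.laplacian (fun y => F (z + proj (L y))) x = ∑ i : Fin d,
      Grushin.dirDeriv (L (EuclideanSpace.single i 1))
        (Grushin.dirDeriv (L (EuclideanSpace.single i 1)) F) (z + proj (L x)) := by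
  have hsm : ∀ {G : Cylinder d → ℂ}, SmoothLift G →
      ContDiff ℝ ((⊤ : ℕ∞) : WithTop ℕ∞) fun y => G (z + proj (L y)) := fun {G} hG => by
    obtain ⟨p, rfl⟩ := isOpenQuotientMap_proj.surjective z
    simp only [← proj_add]
    exact ContDiff.comp (g := fun p => G (proj p)) hG (contDiff_const.add L.contDiff)
  have hfd : ∀ {G : Cylinder d → ℂ}, SmoothLift G → ∀ y e : Space d,
      fderiv ℝ (fun y => G (z + proj (L y))) y e =
        Grushin.dirDeriv (L e) G (z + proj (L y)) := fun {G} hG y e => by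
    rw [← ((hsm hG).differentiable (by simp) y).lineDeriv_eq_fderiv, lineDeriv, Grushin.dirDeriv]
    simp only [map_add, map_smul, proj_add, add_assoc]
  rw [laplacian_eq_sum ((hsm hF).of_le (ENat.LEInfty.out))]
  refine Finset.sum_congr rfl fun i _ => ?_
  simp only [hfd hF]
  rw [hfd (hF.dirDeriv _)]

/-- The `i`-th coordinate direction in the variable `x`. -/
def dirX (i : Fin d) : Space d × Space d := (EuclideanSpace.single i 1, 0)

/-- The `i`-th coordinate direction in the variable `y`. -/
def dirY (i : Fin d) : Space d × Space d := (0, EuclideanSpace.single i 1)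

theorem SmoothLift.laplacianX_eq {F : Cylinder d → ℂ} (hF : SmoothLift F) (z : Cylinder d) :
    laplacianX F z = ∑ i : Fin d, Grushin.dirDeriv (dirX i) (Grushin.dirDeriv (dirX i) F) z := by
  have h := hF.laplacian_slice (ContinuousLinearMap.inl ℝ _ _) (0, z.2) z.1
  have h1 : ∀ y : Space d,
      ((0, z.2) : Cylinder d) + proj (ContinuousLinearMap.inl ℝ (Space d) (Space d) y) =
        (y, z.2) := fun y => by
    ext i <;> simp [proj, toTorus]
  simp only [h1] at h
  exact h

theorem SmoothLift.laplacianY_eq {F : Cylinder d → ℂ} (hF : SmoothLift F) (z : Cylinder d) :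
    laplacianY F z = ∑ i : Fin d, Grushin.dirDeriv (dirY i) (Grushin.dirDeriv (dirY i) F) z := by
  have h := hF.laplacian_slice (ContinuousLinearMap.inr ℝ _ _) z 0
  have h1 : ∀ y : Space d, z + proj (ContinuousLinearMap.inr ℝ (Space d) (Space d) y) =
        (z.1, z.2 + toTorus y) := fun y => by
    ext i <;> simp [proj]
  simp only [h1] at h
  have h2 : z.2 + toTorus (0 : Space d) = z.2 := by
    ext i; simp [toTorus]
  rw [h2] at h
  exact h

/-- The weight `|x| ^ (2 γ)` in front of the Laplacian in `y`. -/
def weight (γ : ℕ) (z : Cylinder d) : ℂ := ((‖z.1‖ ^ (2 * γ) : ℝ) : ℂ)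

theorem smoothLift_weight (γ : ℕ) : SmoothLift (weight (d := d) γ) := by
  unfold SmoothLift weight proj
  simp only [pow_mul]
  exact Complex.ofRealCLM.contDiff.comp ((contDiff_fst.norm_sq ℝ).pow γ)

theorem dirDeriv_weight (γ : ℕ) (i : Fin d) (z : Cylinder d) :
    dirDeriv (dirY i) (weight γ) z = 0 := by
  simp [dirDeriv, weight, proj, dirY]

/-- A smooth pointwise solution of `-Δ_γ u = lam u`, without any integrability, is a solution in the
sense of distributions. -/
theorem integral_mul_neg_grushin {γ : ℕ} {u : Cylinder d → ℂ} (hu : SmoothLift u) {lam : ℝ}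
    (hlam : ∀ z, grushin γ u z = -(lam * u z)) {φ : Cylinder d → ℂ} (hφ : IsTestFunction φ) :
    ∫ z, u z * -(grushin γ φ z) = ∫ z, (lam * u z) * φ z := by
  have hφs : SmoothLift φ := hφ.smooth
  have hc := hφ.compactSupport
  have hone : SmoothLift fun _ : Cylinder d => (1 : ℂ) := contDiff_const
  have hw := smoothLift_weight (d := d) γ
  have hexp : ∀ (v F : Cylinder d → ℂ), SmoothLift F → ∀ z, v z * grushin γ F z =
      ∑ i, 1 * (v z * dirDeriv (dirX i) (dirDeriv (dirX i) F) z) +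
      ∑ i, weight γ z * (v z * dirDeriv (dirY i) (dirDeriv (dirY i) F) z) := fun v F hF z => by
    rw [grushin, hF.laplacianX_eq, hF.laplacianY_eq, ← Finset.mul_sum, ← Finset.mul_sum,
      ← Finset.mul_sum, ← Finset.mul_sum, weight]
    ring
  have hint1 : ∀ ρ : Cylinder d → ℂ, SmoothLift ρ → ∀ w : Space d × Space d,
      Integrable fun z => ρ z * (u z * dirDeriv w (dirDeriv w φ) z) := fun ρ hρ w =>
    (hρ.mul (hu.mul ((hφs.dirDeriv w).dirDeriv w))).continuous.integrable_of_hasCompactSupport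
      (HasCompactSupport.mul_left (HasCompactSupport.mul_left
        (HasCompactSupport.dirDeriv (HasCompactSupport.dirDeriv hc w) w)))
  have hint2 : ∀ ρ : Cylinder d → ℂ, SmoothLift ρ → ∀ w : Space d × Space d,
      Integrable fun z => ρ z * (φ z * dirDeriv w (dirDeriv w u) z) := fun ρ hρ w =>
    (hρ.mul (hφs.mul ((hu.dirDeriv w).dirDeriv w))).continuous.integrable_of_hasCompactSupport
      (HasCompactSupport.mul_left hc.mul_right)
  have hgreen : ∫ z, u z * grushin γ φ z = ∫ z, φ z * grushin γ u z := by
    simp only [hexp u φ hφs, hexp φ u hu]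
    rw [integral_add (integrable_finsetSum _ fun i _ => hint1 _ hone _)
        (integrable_finsetSum _ fun i _ => hint1 _ hw _),
      integral_add (integrable_finsetSum _ fun i _ => hint2 _ hone _)
        (integrable_finsetSum _ fun i _ => hint2 _ hw _),
      integral_finsetSum _ fun i _ => hint1 _ hone _, integral_finsetSum _ fun i _ => hint1 _ hw _,
      integral_finsetSum _ fun i _ => hint2 _ hone _, integral_finsetSum _ fun i _ => hint2 _ hw _]
    congr 1
    · exact Finset.sum_congr rfl fun i _ =>
        integral_mul_dirDeriv_dirDeriv hone hu hφs hc fun z => by simp [dirDeriv]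
    · exact Finset.sum_congr rfl fun i _ =>
        integral_mul_dirDeriv_dirDeriv hw hu hφs hc (dirDeriv_weight γ i)
  simp only [mul_neg]
  rw [integral_neg, hgreen, ← integral_neg]
  refine integral_congr_ae (ae_of_all _ fun z => ?_)
  simp only [hlam]
  ring

/-! ### Separated eigenfunctions -/

theorem laplacian_radial {F F' F'' : ℝ → ℝ} (hF : ∀ t, HasDerivAt F (F' t) t)
    (hF' : ∀ t, HasDerivAt F' (F'' t) t) (hC : ContDiff ℝ 2 F) (x : Space d) :
    Laplacian.laplacian (fun y : Space d => F (‖y‖ ^ 2)) x =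
      4 * ‖x‖ ^ 2 * F'' (‖x‖ ^ 2) + 2 * d * F' (‖x‖ ^ 2) := by
  have hsq : ∀ y : Space d, HasFDerivAt (fun y : Space d => ‖y‖ ^ 2) (2 • innerSL ℝ y) y :=
    fun y => (hasStrictFDerivAt_norm_sq y).hasFDerivAt
  have hin : ∀ (y : Space d) (i : Fin d), inner ℝ y (EuclideanSpace.single i (1 : ℝ)) = y i :=
    fun y i => by simp [EuclideanSpace.inner_single_right]
  rw [laplacian_eq_sum (h := fun y : Space d => F (‖y‖ ^ 2)) (hC.comp (contDiff_norm_sq ℝ))]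
  have h1 : ∀ (i : Fin d) (y : Space d), fderiv ℝ (fun y : Space d => F (‖y‖ ^ 2)) y
      (EuclideanSpace.single i 1) = F' (‖y‖ ^ 2) * (2 * y i) := fun i y => by
    have h3 : HasFDerivAt (fun y : Space d => F (‖y‖ ^ 2)) _ y :=
      (hF _).comp_hasFDerivAt y (hsq y)
    rw [h3.fderiv]
    simp [hin]
  simp only [h1]
  have h2 : ∀ i : Fin d, fderiv ℝ (fun y : Space d => F' (‖y‖ ^ 2) * (2 * y i)) x
      (EuclideanSpace.single i 1) = 4 * F'' (‖x‖ ^ 2) * x i ^ 2 + 2 * F' (‖x‖ ^ 2) := fun i => by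
    have h3 : HasFDerivAt (fun y : Space d => 2 * y i)
        ((2 : ℝ) • (EuclideanSpace.proj i : Space d →L[ℝ] ℝ)) x :=
      ((EuclideanSpace.proj i : Space d →L[ℝ] ℝ).hasFDerivAt (x := x)).const_mul 2
    have h4 : HasFDerivAt (fun y : Space d => F' (‖y‖ ^ 2) * (2 * y i)) _ x :=
      ((hF' _).comp_hasFDerivAt x (hsq x)).mul h3
    rw [h4.fderiv]
    simp [hin]
    ring
  simp only [h2]
  rw [Finset.sum_add_distrib, ← Finset.mul_sum, ← EuclideanSpace.real_norm_sq_eq]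
  simp
  ring

/-- The separated function `e^{i n y_i} g(a |x|)` on the cylinder. -/
def mode (γ n : ℕ) (lam a : ℝ) (i : Fin d) (z : Cylinder d) : ℂ :=
  (profile d γ lam (a * ‖z.1‖) : ℂ) * fourier (n : ℤ) (z.2 i)

theorem fourier_add_coe (n : ℤ) (y : AddCircle (2 * Real.pi)) (t : ℝ) :
    fourier n (y + (t : AddCircle (2 * Real.pi))) =
      fourier n y * Complex.exp (Complex.I * n * t) := by
  have h : fourier n (y + (t : AddCircle (2 * Real.pi))) =
      fourier n y * fourier n (t : AddCircle (2 * Real.pi)) := by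
    simp [fourier_apply, AddCircle.toCircle_add]
  rw [h, fourier_coe_apply]
  congr 2
  have : (Real.pi : ℂ) ≠ 0 := Complex.ofReal_ne_zero.2 Real.pi_ne_zero
  push_cast
  field_simp

variable {γ n : ℕ} {lam a : ℝ} {i : Fin d}

theorem smoothLift_mode (hd : 1 ≤ d) : SmoothLift (mode γ n lam a i) := by
  unfold SmoothLift mode proj toTorus profile
  refine ContDiff.mul (Complex.ofRealCLM.contDiff.comp
    ((contDiff_radialSol hd γ lam).comp ?_)) ?_
  · simp only [mul_pow]
    exact contDiff_const.mul (contDiff_fst.norm_sq ℝ)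
  · simp only [fourier_coe_apply]
    refine Complex.contDiff_exp.comp (ContDiff.div_const (contDiff_const.mul ?_) _)
    exact Complex.ofRealCLM.contDiff.comp
      ((EuclideanSpace.proj i : Space d →L[ℝ] ℝ).contDiff.comp contDiff_snd)

theorem norm_mode (z : Cylinder d) :
    ‖mode γ n lam a i z‖ = |profile d γ lam (a * ‖z.1‖)| := by
  rw [mode, norm_mul, fourier_apply, Circle.norm_coe, mul_one, Complex.norm_real, Real.norm_eq_abs]

/-- The mode is an eigenfunction of the derivatives in `y`; the constant factor `c` lets the
formula be applied twice. -/
theorem dirDeriv_dirY_const_mul_mode (c : ℂ) (j : Fin d) (z : Cylinder d) :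
    dirDeriv (dirY j) (fun z => c * mode γ n lam a i z) z =
      (if j = i then Complex.I * n else 0) * (c * mode γ n lam a i z) := by
  have h1 : ∀ t : ℝ, c * mode γ n lam a i (z + proj (t • dirY j)) =
      c * mode γ n lam a i z * Complex.exp ((if j = i then Complex.I * n else 0) * t) := fun t => by
    have h2 : (z + proj (t • dirY j)).1 = z.1 := by simp [proj, dirY]
    have h3 : (z + proj (t • dirY j)).2 i =
        z.2 i + (((if j = i then t else 0 : ℝ)) : AddCircle (2 * Real.pi)) := by
      simp [proj, dirY, toTorus, eq_comm]
    rw [mode, h2, h3, fourier_add_coe, mode]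
    split_ifs <;> simp [mul_assoc]
  rw [dirDeriv]
  simp only [h1]
  have h4 : HasDerivAt (fun t : ℝ => c * mode γ n lam a i z *
      Complex.exp ((if j = i then Complex.I * n else 0) * t)) _ 0 :=
    ((((hasDerivAt_id (0 : ℝ)).ofReal_comp).const_mul _).cexp).const_mul _
  rw [h4.deriv]
  split_ifs <;> simp [mul_comm]

theorem laplacianY_mode (hd : 1 ≤ d) (z : Cylinder d) :
    laplacianY (mode γ n lam a i) z = -(n ^ 2 * mode γ n lam a i z) := by
  rw [(smoothLift_mode hd).laplacianY_eq]
  have h1 : ∀ j, dirDeriv (dirY j) (mode γ n lam a i) =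
      fun z => (if j = i then Complex.I * n else 0) * mode γ n lam a i z := fun j =>
    funext fun z => by simpa using dirDeriv_dirY_const_mul_mode (γ := γ) (n := n) 1 j z
  simp only [h1, dirDeriv_dirY_const_mul_mode]
  rw [Finset.sum_eq_single i (fun j _ hj => by simp [hj]) (by simp)]
  simp only [if_true]
  linear_combination (n : ℂ) ^ 2 * mode γ n lam a i z * Complex.I_sq

theorem laplacianX_mode (hd : 1 ≤ d) (ha : a ^ (γ + 1) = n) (z : Cylinder d) :
    laplacianX (mode γ n lam a i) z =
      ((n : ℂ) ^ 2 * ((‖z.1‖ ^ (2 * γ) : ℝ) : ℂ) - ((lam * a ^ 2 : ℝ) : ℂ)) *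
        mode γ n lam a i z := by
  set F : ℝ → ℝ := fun t => radialSol d γ lam (a ^ 2 * t) with hF
  have hlin : ∀ t, HasDerivAt (fun t => a ^ 2 * t) (a ^ 2) t := fun t => by
    simpa using (hasDerivAt_id t).const_mul (a ^ 2)
  have h1 : ∀ t, HasDerivAt F (a ^ 2 * radialSol' d γ lam (a ^ 2 * t)) t := fun t => by
    rw [mul_comm]
    exact (hasDerivAt_radialSol hd γ lam _).comp t (hlin t)
  have h2 : ∀ t, HasDerivAt (fun t => a ^ 2 * radialSol' d γ lam (a ^ 2 * t))
      (a ^ 2 * (radialSol'' d γ lam (a ^ 2 * t) * a ^ 2)) t := fun t =>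
    ((hasDerivAt_radialSol' hd γ lam _).comp t (hlin t)).const_mul _
  have hC : ContDiff ℝ 2 F :=
    ((contDiff_radialSol hd γ lam).of_le ENat.LEInfty.out).comp (contDiff_const.mul contDiff_id)
  have hlap := laplacian_radial h1 h2 hC z.1
  have hode := radialSol_ode hd γ lam (a ^ 2 * ‖z.1‖ ^ 2)
  have hn : (n : ℝ) ^ 2 = a ^ 2 * (a ^ 2) ^ γ := by rw [← ha]; ring
  have hlap' : Laplacian.laplacian (fun y : Space d => F (‖y‖ ^ 2)) z.1 =
      ((n : ℝ) ^ 2 * ‖z.1‖ ^ (2 * γ) - lam * a ^ 2) * F (‖z.1‖ ^ 2) := by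
    rw [hlap, hn, pow_mul, hF]
    rw [mul_pow] at hode
    linear_combination a ^ 2 * hode
  have hcomp : (fun x : Space d => mode γ n lam a i (x, z.2)) =
      (ContinuousLinearMap.toSpanSingleton ℝ (fourier (n : ℤ) (z.2 i))) ∘
        (fun y : Space d => F (‖y‖ ^ 2)) := funext fun x => by
    simp [mode, profile, hF, mul_pow]
  have hCF : ContDiff ℝ 2 fun y : Space d => F (‖y‖ ^ 2) := hC.comp (contDiff_norm_sq ℝ)
  rw [laplacianX, hcomp, hCF.contDiffAt.laplacian_CLM_comp_left]
  simp only [Function.comp, hlap']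
  rw [ContinuousLinearMap.toSpanSingleton_apply, Complex.real_smul, mode, profile, hF, mul_pow]
  push_cast
  ring

theorem grushin_mode (hd : 1 ≤ d) (ha : a ^ (γ + 1) = n) (z : Cylinder d) :
    grushin γ (mode γ n lam a i) z = -(((lam * a ^ 2 : ℝ) : ℂ) * mode γ n lam a i z) := by
  rw [grushin, laplacianX_mode hd ha, laplacianY_mode hd]
  ring

theorem isEigenpair_toLp_mode (hd : 1 ≤ d) (ha : a ^ (γ + 1) = n)
    (hm : MemLp (mode γ n lam a i) 2 volume) (h0 : hm.toLp ≠ 0) :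
    IsEigenpair γ (lam * a ^ 2) hm.toLp := by
  refine ⟨h0, fun φ hφ => ?_⟩
  have h1 := hm.coeFn_toLp
  have h2 := Lp.coeFn_smul ((lam * a ^ 2 : ℝ) : ℂ) hm.toLp
  have h := integral_mul_neg_grushin (smoothLift_mode (lam := lam) (i := i) hd)
    (grushin_mode hd ha) hφ
  rw [integral_congr_ae (g := fun z => mode γ n lam a i z * -(grushin γ φ z))
    (by filter_upwards [h1] with z hz using by rw [hz]), h]
  refine integral_congr_ae ?_
  filter_upwards [h1, h2] with z hz1 hz2
  rw [hz2, Pi.smul_apply, hz1, smul_eq_mul]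

/-! ### Concentration and optimality of the exponent -/

/-- Scaling in `x` and integration over the torus multiply all `L²` norms by the same factor, so
they drop out of quotients of norms. -/
theorem eLpNorm_comp_smul_fst (d : ℕ) {a : ℝ} (ha : a ≠ 0) :
    ∃ k : ENNReal, k ≠ 0 ∧ k ≠ ⊤ ∧ ∀ Φ : Space d → ℝ, Continuous Φ →
      eLpNorm (fun z : Cylinder d => Φ (a • z.1)) 2 volume = k * eLpNorm Φ 2 volume := by
  have hT0 : (volume : Measure (Torus d)) Set.univ ≠ 0 := by
    rw [Measure.measure_univ_ne_zero]
    exact NeZero.ne _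
  have hT : (volume : Measure (Torus d)) Set.univ ≠ ⊤ := measure_ne_top _ _
  have hr0 : ENNReal.ofReal |(a ^ Module.finrank ℝ (Space d))⁻¹| ≠ 0 := by
    rw [ENNReal.ofReal_ne_zero_iff]
    positivity
  set r := ENNReal.ofReal |(a ^ Module.finrank ℝ (Space d))⁻¹| with hr
  set v := (volume : Measure (Torus d)) Set.univ with hv
  have hmap : Measure.map (fun z : Cylinder d => a • z.1) volume =
      (v * r) • (volume : Measure (Space d)) := by
    have h1 : (fun z : Cylinder d => a • z.1) = (fun x : Space d => a • x) ∘ Prod.fst := rfl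
    rw [h1, ← Measure.map_map (measurable_const_smul a) measurable_fst,
      Measure.volume_eq_prod, Measure.map_fst_prod, Measure.map_smul,
      Measure.map_addHaar_smul _ ha, smul_smul]
  have hm0 : v * r ≠ 0 := mul_ne_zero hT0 hr0
  have hm1 : v * r ≠ ⊤ := ENNReal.mul_ne_top hT ENNReal.ofReal_ne_top
  refine ⟨(v * r) ^ (1 / (2 : ENNReal)).toReal, ?_, ?_, fun Φ hΦ => ?_⟩
  · exact (ENNReal.rpow_pos (pos_iff_ne_zero.2 hm0) hm1).ne'
  · exact ENNReal.rpow_ne_top_of_nonneg ENNReal.toReal_nonneg hm1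
  · have h1 := eLpNorm_smul_measure_of_ne_top (p := 2) (by norm_num) Φ (v * r)
      (μ := (volume : Measure (Space d)))
    rw [← hmap, eLpNorm_map_measure hΦ.aestronglyMeasurable (by fun_prop), smul_eq_mul] at h1
    exact h1

theorem memLp_exp_neg_norm_pow {κ : ℝ} (hκ : 0 < κ) (hγ : 1 ≤ γ) :
    MemLp (fun x : Space d => Real.exp (-(κ / 2 * ‖x‖ ^ (γ + 1)))) 2 volume := by
  have hcont : Continuous fun x : Space d => Real.exp (-(κ / 2 * ‖x‖ ^ (γ + 1))) := by fun_prop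
  rw [memLp_two_iff_integrable_sq hcont.aestronglyMeasurable]
  -- Since `γ ≥ 1`, `|x| ^ (γ + 1) ≥ |x|² - 1`, and a Gaussian dominates.
  have hg : Integrable fun x : Space d => Real.exp κ * Real.exp (-(κ * ‖x‖ ^ 2)) := by
    have h := (GaussianFourier.integrable_cexp_neg_mul_sq_norm_add (V := Space d) (b := (κ : ℂ))
      (by simpa using hκ) 0 0).norm
    refine (h.const_mul (Real.exp κ)).congr (ae_of_all _ fun x => ?_)
    simp [Complex.norm_exp, ← Complex.ofReal_pow]
  refine hg.mono' (hcont.pow 2).aestronglyMeasurable (ae_of_all _ fun x => ?_)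
  rw [Real.norm_eq_abs, abs_of_nonneg (by positivity), ← Real.exp_nat_mul, ← Real.exp_add,
    Real.exp_le_exp]
  have h1 : ‖x‖ ^ 2 - 1 ≤ ‖x‖ ^ (γ + 1) := by
    rcases le_total ‖x‖ 1 with h | h
    · have := pow_le_one₀ (n := 2) (norm_nonneg x) h
      have := pow_nonneg (norm_nonneg x) (γ + 1)
      linarith
    · have := pow_le_pow_right₀ h (show 2 ≤ γ + 1 by omega)
      linarith
  push_cast
  nlinarith

/-- The torus is compact, so the projection of `closure ω` to `ℝ^d` is closed; it misses the
origin. -/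
theorem exists_dist_of_closure_disjoint {ω : Set (Cylinder d)}
    (hdisj : closure ω ∩ {z | z.1 = 0} = ∅) :
    ∃ δ : ℝ, 0 < δ ∧ ∀ z ∈ ω, δ ≤ ‖z.1‖ := by
  have hcl : IsClosed (Prod.fst '' closure ω) := isClosedMap_fst_of_compactSpace _ isClosed_closure
  have h0 : (0 : Space d) ∈ (Prod.fst '' closure ω)ᶜ := by
    rintro ⟨z, hz, hz0⟩
    exact Set.notMem_empty z (hdisj ▸ ⟨hz, hz0⟩)
  obtain ⟨δ, hδ, hball⟩ := Metric.isOpen_iff.1 hcl.isOpen_compl 0 h0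
  refine ⟨δ, hδ, fun z hz => ?_⟩
  by_contra! h
  exact hball (mem_ball_zero_iff.2 h) ⟨z, subset_closure hz, rfl⟩

/-- The modes with frequency `n + 1` concentrate near `{x = 0}` at the exponential rate `n + 1`,
which is proportional to the power `(1 + γ) / 2` of the eigenvalue. -/
theorem exists_concentrating_eigenpairs {γ : ℕ} (hd : 1 ≤ d) (hγ : 1 ≤ γ) {ω : Set (Cylinder d)}
    (hdisj : closure ω ∩ {z | z.1 = 0} = ∅) :
    ∃ c₀ c₁ : ℝ, 0 < c₀ ∧ 0 < c₁ ∧ ∃ (lam : ℕ → ℝ) (ψ : ℕ → L2 d),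
      (∀ n, IsEigenpair γ (lam n) (ψ n)) ∧ Tendsto lam atTop atTop ∧
      ∀ n, c₀ * Real.exp (c₁ * lam n ^ ((1 + (γ : ℝ)) / 2)) * normOn ω (ψ n) ≤ ‖ψ n‖ := by
  obtain ⟨lam, C, κ, hlam, hκ, hprof⟩ := exists_ground_state hd hγ
  obtain ⟨δ, hδ, hωδ⟩ := exists_dist_of_closure_disjoint hdisj
  have hC : 0 < C := by
    by_contra! h
    have h1 := (hprof 0 le_rfl)
    have h2 := mul_nonpos_of_nonpos_of_nonneg h (Real.exp_pos (-(κ * 0 ^ (γ + 1)))).le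
    linarith [h1.1, h1.2]
  -- The ground state is at most `C Ψ²`: one factor `Ψ` provides square integrability, the other one
  -- the smallness away from `x = 0`.
  set Φ : Space d → ℝ := fun x => profile d γ lam ‖x‖ with hΦ
  set Ψ : Space d → ℝ := fun x => Real.exp (-(κ / 2 * ‖x‖ ^ (γ + 1))) with hΨ
  have hΦc : Continuous Φ := (continuous_profile_right hd γ lam).comp continuous_norm
  have hΨc : Continuous Ψ := by fun_prop
  have hΨm : MemLp Ψ 2 volume := memLp_exp_neg_norm_pow hκ hγ
  have hΦm : MemLp Φ 2 volume := by
    refine (hΨm.const_mul C).mono hΦc.aestronglyMeasurable (ae_of_all _ fun x => ?_)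
    have h := hprof ‖x‖ (norm_nonneg x)
    rw [Real.norm_eq_abs, Real.norm_eq_abs, abs_of_pos h.1, abs_of_pos (by positivity)]
    refine h.2.trans (mul_le_mul_of_nonneg_left (Real.exp_le_exp.2 ?_) hC.le)
    have := mul_nonneg hκ.le (pow_nonneg (norm_nonneg x) (γ + 1))
    linarith
  have hΦ0 : eLpNorm Φ 2 volume ≠ 0 := by
    rw [Ne, eLpNorm_eq_zero_iff hΦc.aestronglyMeasurable two_ne_zero]
    intro h
    obtain ⟨x, hx⟩ := h.exists
    exact (hprof ‖x‖ (norm_nonneg x)).1.ne' hx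
  set A := (eLpNorm Φ 2 volume).toReal with hA
  set B := (eLpNorm Ψ 2 volume).toReal with hB
  have hA0 : 0 < A := ENNReal.toReal_pos hΦ0 hΦm.2.ne
  have hB0 : 0 ≤ B := ENNReal.toReal_nonneg
  set p : ℝ := (1 + (γ : ℝ)) / 2 with hp
  set a : ℕ → ℝ := fun n => ((n + 1 : ℕ) : ℝ) ^ (1 / ((γ : ℝ) + 1)) with ha
  have ha0 : ∀ n, 0 < a n := fun n => by positivity
  have hapow : ∀ n, a n ^ (γ + 1) = ((n + 1 : ℕ) : ℝ) := fun n => by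
    rw [ha, ← Real.rpow_natCast, ← Real.rpow_mul (by positivity)]
    push_cast
    rw [one_div_mul_cancel (by positivity), Real.rpow_one]
  set i₀ : Fin d := ⟨0, hd⟩
  choose k hk0 hk1 hk using fun n => eLpNorm_comp_smul_fst d (ha0 n).ne'
  have hnorm : ∀ (n : ℕ) (z : Cylinder d),
      ‖mode γ (n + 1) lam (a n) i₀ z‖ = Φ (a n • z.1) := fun n z => by
    have h0 : 0 ≤ a n * ‖z.1‖ := mul_nonneg (ha0 n).le (norm_nonneg _)
    rw [norm_mode, abs_of_pos (hprof _ h0).1, hΦ]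
    simp only [norm_smul, Real.norm_eq_abs, abs_of_pos (ha0 n)]
  have hfull : ∀ n, eLpNorm (mode γ (n + 1) lam (a n) i₀) 2 volume =
      k n * eLpNorm Φ 2 volume := fun n => by
    rw [← hk n Φ hΦc]
    refine eLpNorm_congr_norm_ae (ae_of_all _ fun z => ?_)
    rw [hnorm, Real.norm_eq_abs, abs_of_pos (hprof _ (norm_nonneg _)).1]
  have hmem : ∀ n, MemLp (mode γ (n + 1) lam (a n) i₀) 2 volume := fun n =>
    ⟨(smoothLift_mode hd).continuous.aestronglyMeasurable, by
      rw [hfull]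
      exact ENNReal.mul_lt_top (hk1 n).lt_top hΦm.2⟩
  have hψnorm : ∀ n, ‖(hmem n).toLp‖ = (k n).toReal * A := fun n => by
    rw [Lp.norm_toLp, hfull, ENNReal.toReal_mul]
  have hk' : ∀ n, 0 < (k n).toReal := fun n => ENNReal.toReal_pos (hk0 n) (hk1 n)
  have hlocal : ∀ n, normOn ω (hmem n).toLp ≤
      C * Real.exp (-(κ / 2 * δ ^ (γ + 1) * ((n + 1 : ℕ) : ℝ))) * ((k n).toReal * B) := fun n => by
    set ε := C * Real.exp (-(κ / 2 * δ ^ (γ + 1) * ((n + 1 : ℕ) : ℝ))) with hε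
    have hε0 : 0 ≤ ε := by positivity
    set S : Set (Cylinder d) := {z | δ ≤ ‖z.1‖}
    have hS : MeasurableSet S := (isClosed_le continuous_const continuous_fst.norm).measurableSet
    have h1 : eLpNorm (hmem n).toLp 2 (volume.restrict ω) ≤
        ENNReal.ofReal ε * (k n * eLpNorm Ψ 2 volume) := by
      rw [eLpNorm_congr_ae (ae_restrict_of_ae (hmem n).coeFn_toLp), ← hk n Ψ hΨc]
      refine (eLpNorm_mono_measure _ (Measure.restrict_mono_set volume (hωδ : ω ⊆ S))).trans ?_
      refine (eLpNorm_le_mul_eLpNorm_of_ae_le_mul (g := fun z : Cylinder d => Ψ (a n • z.1))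
        (ae_restrict_of_forall_mem hS fun z hz => ?_) 2).trans
        (mul_le_mul_right (eLpNorm_mono_measure _ Measure.restrict_le_self) _)
      have hz' : δ ≤ ‖z.1‖ := hz
      rw [hnorm, Real.norm_eq_abs, abs_of_pos (Real.exp_pos _)]
      refine (hprof _ (norm_nonneg _)).2.trans ?_
      rw [hε, mul_assoc, ← Real.exp_add]
      gcongr
      have h2 : δ ^ (γ + 1) * ((n + 1 : ℕ) : ℝ) ≤ ‖a n • z.1‖ ^ (γ + 1) := by
        rw [norm_smul, mul_pow, Real.norm_eq_abs, abs_of_pos (ha0 n), hapow, mul_comm]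
        gcongr
      nlinarith
    have h2 : ENNReal.ofReal ε * (k n * eLpNorm Ψ 2 volume) ≠ ⊤ :=
      ENNReal.mul_ne_top ENNReal.ofReal_ne_top (ENNReal.mul_ne_top (hk1 n) hΨm.2.ne)
    have h3 := ENNReal.toReal_mono h2 h1
    rwa [ENNReal.toReal_mul, ENNReal.toReal_mul, ENNReal.toReal_ofReal hε0] at h3
  have hlampow : ∀ n, (lam * a n ^ 2) ^ p = lam ^ p * ((n + 1 : ℕ) : ℝ) := fun n => by
    rw [Real.mul_rpow hlam.le (by positivity), ← hapow n, ← Real.rpow_natCast (a n) 2,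
      ← Real.rpow_mul (ha0 n).le, ← Real.rpow_natCast (a n) (γ + 1)]
    congr 2
    rw [hp]
    push_cast
    ring
  have hlamp : 0 < lam ^ p := Real.rpow_pos_of_pos hlam p
  refine ⟨A / (C * (B + 1)), κ / 2 * δ ^ (γ + 1) / lam ^ p, by positivity, by positivity,
    fun n => lam * a n ^ 2, fun n => (hmem n).toLp, fun n => ?_, ?_, fun n => ?_⟩
  · refine isEigenpair_toLp_mode hd (hapow n) (hmem n) fun h => ?_
    have h1 := hψnorm n
    rw [h, norm_zero] at h1
    exact (mul_pos (hk' n) hA0).ne h1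
  · have h1 : Tendsto a atTop atTop :=
      (tendsto_rpow_atTop (by positivity)).comp
        (tendsto_natCast_atTop_atTop.comp (tendsto_add_atTop_nat 1))
    exact ((tendsto_pow_atTop two_ne_zero).comp h1).const_mul_atTop hlam
  · rw [hψnorm, hlampow]
    have h1 : κ / 2 * δ ^ (γ + 1) / lam ^ p * (lam ^ p * ((n + 1 : ℕ) : ℝ)) =
        κ / 2 * δ ^ (γ + 1) * ((n + 1 : ℕ) : ℝ) := by
      field_simp
    rw [h1]
    set E := κ / 2 * δ ^ (γ + 1) * ((n + 1 : ℕ) : ℝ)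
    calc A / (C * (B + 1)) * Real.exp E * normOn ω (hmem n).toLp
        ≤ A / (C * (B + 1)) * Real.exp E * (C * Real.exp (-E) * ((k n).toReal * B)) := by
          gcongr
          exact hlocal n
      _ = (k n).toReal * A * (B / (B + 1)) := by
          rw [Real.exp_neg]
          field_simp
      _ ≤ (k n).toReal * A * 1 := by
          have := hk' n
          gcongr
          rw [div_le_one (by positivity)]
          linarith
      _ = (k n).toReal * A := mul_one _

/-- An exponential of a power `p` cannot be bounded by one of a smaller power `η`, of any sign,
along a sequence that tends to infinity. -/
theorem not_tendsto_of_exp_rpow_le {c₀ c₁ C K p η : ℝ} (hc₀ : 0 < c₀) (hc₁ : 0 < c₁) (hp : 0 < p)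
    (hη : η < p) {lam : ℕ → ℝ}
    (h : ∀ n, c₀ * Real.exp (c₁ * lam n ^ p) ≤ C * Real.exp (K * (1 + lam n) ^ η)) :
    ¬ Tendsto lam atTop atTop := by
  intro hlim
  have hC : 0 < C := by
    have h1 := (by positivity : 0 < c₀ * Real.exp (c₁ * lam 0 ^ p)).trans_le (h 0)
    exact pos_of_mul_pos_left h1 (Real.exp_pos _).le
  set q := max η 0 with hq
  have hq0 : 0 ≤ q := le_max_right _ _
  have hqp : q < p := max_lt hη hp
  have hbig : Tendsto (fun n => c₁ * lam n ^ (p - q)) atTop atTop :=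
    ((tendsto_rpow_atTop (sub_pos.2 hqp)).comp hlim).const_mul_atTop hc₁
  obtain ⟨n, hn1, hn2⟩ := ((hlim.eventually_ge_atTop 1).and
    (hbig.eventually_gt_atTop (|K| * 2 ^ q + |Real.log (C / c₀)|))).exists
  set x := lam n
  have hx0 : 0 < x := by linarith
  have hxq : 1 ≤ x ^ q := Real.one_le_rpow hn1 hq0
  have h1 : (1 + x) ^ η ≤ 2 ^ q * x ^ q := by
    rw [← Real.mul_rpow (by norm_num) hx0.le]
    calc (1 + x) ^ η ≤ (1 + x) ^ q :=
          Real.rpow_le_rpow_of_exponent_le (by linarith) (le_max_left _ _)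
      _ ≤ (2 * x) ^ q := Real.rpow_le_rpow (by linarith) (by linarith) hq0
  have h2 : K * (1 + x) ^ η ≤ |K| * (2 ^ q * x ^ q) :=
    calc K * (1 + x) ^ η ≤ |K| * (1 + x) ^ η := by gcongr; exact le_abs_self K
      _ ≤ _ := by gcongr
  have h3 : c₁ * x ^ p ≤ Real.log (C / c₀) + K * (1 + x) ^ η := by
    rw [← Real.exp_le_exp, Real.exp_add, Real.exp_log (by positivity), div_mul_eq_mul_div,
      le_div_iff₀ hc₀, mul_comm]
    exact h n
  have h4 : x ^ p = x ^ q * x ^ (p - q) := by rw [← Real.rpow_add hx0]; ring_nf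
  have h5 : x ^ q * (|K| * 2 ^ q + |Real.log (C / c₀)|) < x ^ q * (c₁ * x ^ (p - q)) := by gcongr
  have h6 := le_abs_self (Real.log (C / c₀))
  have h7 := mul_le_mul_of_nonneg_right hxq (abs_nonneg (Real.log (C / c₀)))
  rw [h4] at h3
  linarith

end Grushin

end

theorem proposition2p7 (d γ : ℕ) (hd : 1 ≤ d) (hγ : 1 ≤ γ)
    (ω : Set (Grushin.Cylinder d)) (hω : NullMeasurableSet ω volume)
    (hdisj : closure ω ∩ {z | z.1 = 0} = ∅) :
    (∃ c₀ c₁ : ℝ, 0 < c₀ ∧ 0 < c₁ ∧ ∃ (lam : ℕ → ℝ) (ψ : ℕ → Grushin.L2 d),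
      (∀ n, Grushin.IsEigenpair γ (lam n) (ψ n)) ∧
      Tendsto lam atTop atTop ∧
      ∀ n, c₀ * Real.exp (c₁ * lam n ^ ((1 + (γ : ℝ)) / 2)) * Grushin.normOn ω (ψ n) ≤ ‖ψ n‖) ∧
    ∀ η C K : ℝ,
      (∀ (lam : ℝ) (ψ : Grushin.L2 d), Grushin.IsEigenpair γ lam ψ →
        ‖ψ‖ ≤ C * Real.exp (K * (1 + lam) ^ η) * Grushin.normOn ω ψ) →
      (1 + (γ : ℝ)) / 2 ≤ η := by
  have hmain := Grushin.exists_concentrating_eigenpairs hd hγ hdisj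
  refine ⟨hmain, fun η C K hCK => ?_⟩
  obtain ⟨c₀, c₁, hc₀, hc₁, lam, ψ, heig, hlim, hle⟩ := hmain
  by_contra! hη
  refine Grushin.not_tendsto_of_exp_rpow_le (C := C) (K := K) hc₀ hc₁ (by positivity) hη
    (fun n => ?_) hlim
  have h1 := hCK _ _ (heig n)
  -- The assumed inequality itself rules out `ψ n = 0` on `ω`, so one may divide by this norm.
  have h2 : 0 < Grushin.normOn ω (ψ n) := by
    refine ENNReal.toReal_nonneg.lt_of_ne' fun h0 => ?_
    rw [show Grushin.normOn ω (ψ n) = 0 from h0, mul_zero] at h1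
    exact (norm_pos_iff.2 (heig n).1).not_ge h1
  exact le_of_mul_le_mul_right ((hle n).trans h1) h2
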